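/- Let $\mathscr C\subset\mathbb R^2$ be nonempty and compact with piecewise $C^1$ boundary (i.e. outside finitely many points, $\partial\mathscr C$ is locally the level set $\{g=0\}$ of a $C^1$ function $g$ with $\nabla g\neq0$ and $\mathscr C$ is locally $\{g\le 0\}$), and let $\hat n$ be its outward unit normal. Let $\Sigma_0\succ0$, $\Sigma_1\succeq 0$ be symmetric $2\times2$ matrices, $\mathbf M\in C^0(\mathbb R^2;\mathrm{Sym}_2(\mathbb R))$ with $\mathbf M(y)\succ0$ for all $y$, and $\|\cdot\|_{2,\varepsilon}\ge 0$, $\varepsilon\ge0$, a continuous regularisation of the Euclidean norm ($C^1$ for $\varepsilon>0$, with $\|\cdot\|_{2,0}=\|\cdot\|_2$). For $0<V_{\min}\le V_{\max}$, a rolling speed $V_r\in C^1(\mathbb R_{\ge0};[V_{\min},V_{\max}])$ and $v\in\mathbb R^2$ put $y=V_r(s)v$ and $$\mathbf G(y)=\Sigma_1\|\mathbf M(y)y\|_{2,\varepsilon}+\mathbf M(y)^2,\quad \Sigma(v,s)=-\tfrac1{V_r(s)}\mathbf G(y)^{-1}\Sigma_0\|\mathbf M(y)y\|_{2,\varepsilon},\quad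 \mathbf H(v,s)=-\mathbf G(y)^{-1}\mathbf M(y)^2 .$$ For a rigid slip velocity $\bar v\in C^1(\mathscr C\times\mathbb R_{\ge0};\mathbb R^2)\cap L^\infty$, consider on $\mathring{\mathscr C}\times(0,\infty)$ the problem $$\partial_s z+(\bar V(x)\cdot\nabla)z=\bigl[\Sigma(\bar v(x,s),s)-B(x,s)\bigr]z+\mathbf H(\bar v(x,s),s)\bar v(x,s),\qquad z=0 \text{ on } \mathscr L,\qquad z(\cdot,0)=z_0,$$ where $\mathscr L=\{x\in\partial\mathscr C:\bar V(x)\cdot\hat n(x)<0\}$, in two cases: * the standard linear model: $\bar V=(-1,0)^{\mathrm T}$ and $B=0$; * the linear large-spin model: $\bar V(x)=-\begin{bmatrix}\epsilon_y\\-\epsilon_x\end{bmatrix}+\begin{bmatrix}0&\varphi_1\\-\varphi_1&0\end{bmatrix}x$ with a constant unit vector $\epsilon=(\epsilon_x,\epsilon_y)$ and a constant $\varphi_1\neq0$, and $B(x,s)=\mathbf H(\bar v(x,s),s)\begin{bmatrix}0&-\varphi_2(s)\\ \varphi_2(s)&0\end{bmatrix}$ with $\varphi_2\in C^1(\mathbb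 R_{\ge0})\cap L^\infty(\mathbb R_{\ge 0})$. A classical solution is $z\in C^1(\mathbb R_{\ge0};L^2(\mathring{\mathscr C};\mathbb R^2))\cap C^0(\mathbb R_{\ge0};H^1(\mathring{\mathscr C};\mathbb R^2))$ satisfying the equation, the boundary condition (in the sense of traces) and the initial condition, where $z_0\in H^1$ satisfies the boundary condition. Let $\mathcal K$ be the class of continuous strictly increasing functions on $\mathbb R_{\ge0}$ vanishing at $0$, $\mathcal K_\infty$ its unbounded members, and $\mathcal{KL}$ the class of continuous $\beta:\mathbb R_{\ge0}^2\to\mathbb R_{\ge0}$ with $\beta(\cdot,t)\in\mathcal K$ for all $t$, $\beta(r,\cdot)$ strictly decreasing for $r>0$, and $\beta(r,t)\to0$ as $t\to\infty$. Then: 1. (Standard linear model.) There exist $\beta\in\mathcal{KL}$ and $\gamma\in\mathcal K_\infty$ such that for all $\bar v$, $V_r$, $z_0$ as above, every classical solution satisfies $$\|z(\cdot,s)\|_{L^2(\mathring{\mathscr C};\mathbb R^2)}\le\beta\bigl(\|z_0\|_{L^2(\mathring{\mathscr C};\mathbb R^2)},s\bigr)+\gamma\bigl(\|\bar v\|_\infty\bigr),\qquad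 s\ge0 .$$ 2. (Linear large-spin model.) Assume additionally that $x_C=\epsilon/\varphi_1\notin\mathscr C$ and that there are $\bar\nu\in\mathbb R^2\setminus\{0\}$ and $\bar\eta>0$ with $\bar\nu\cdot(x-x_C)<-\bar\eta$ for all $x\in\mathscr C$. Then for every $\Phi\ge 0$ there exist $\beta\in\mathcal{KL}$ and $\gamma\in\mathcal K_\infty$ such that the same estimate holds for every classical solution, for all $\bar v$, $V_r$, $z_0$ as above and all $\varphi_2$ with $\|\varphi_2\|_\infty\le\Phi$. -/

import Mathlib

open Set Filter Topology MeasureTheory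
open scoped ContDiff Matrix Gradient

noncomputable section

/-- The Euclidean plane. -/
abbrev Plane : Type := EuclideanSpace ℝ (Fin 2)

/-! ### Comparison functions on `[0, ∞)` -/

/-- Class `𝒦`: continuous and strictly increasing on `[0, ∞)`, vanishing at `0`. -/
structure IsClassK (f : ℝ → ℝ) : Prop where
  continuousOn : ContinuousOn f (Ici 0)
  strictMonoOn : StrictMonoOn f (Ici 0)
  map_zero : f 0 = 0

/-- Class `𝒦_∞`: an unbounded function of class `𝒦`. -/
structure IsClassKInf (f : ℝ → ℝ) : Prop where
  isClassK : IsClassK f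
  unbounded : ∀ b : ℝ, ∃ r : ℝ, 0 ≤ r ∧ b < f r

/-- Class `𝒦ℒ`. Since `β 0 t = 0` for every `t`, strict decrease in the second argument is
meaningful only for a positive first argument. -/
structure IsClassKL (β : ℝ → ℝ → ℝ) : Prop where
  continuousOn : ContinuousOn (Function.uncurry β) (Ici 0 ×ˢ Ici 0)
  isClassK : ∀ t : ℝ, 0 ≤ t → IsClassK (fun r => β r t)
  strictAntiOn : ∀ r : ℝ, 0 < r → StrictAntiOn (β r) (Ici 0)
  tendsto_zero : ∀ r : ℝ, 0 ≤ r → Tendsto (β r) atTop (𝓝 0)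

/-! ### Geometry of the contact area -/

/-- `n` is the outward unit normal to `C` at the regular boundary point `x`: near `x`, the set `C`
is the sublevel set `{g ≤ 0}` of a `C¹` function `g` with `g x = 0` whose gradient at `x` is a
positive multiple of `n`. -/
def IsOutwardNormal (C : Set Plane) (x n : Plane) : Prop :=
  ‖n‖ = 1 ∧ ∃ (U : Set Plane) (g : Plane → ℝ) (a : ℝ),
    IsOpen U ∧ x ∈ U ∧ ContDiffOn ℝ 1 g U ∧ g x = 0 ∧ 0 < a ∧ ∇ g x = a • n ∧
    C ∩ U = {y ∈ U | g y ≤ 0}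

/-- The boundary of `C` is piecewise `C¹`: apart from finitely many (corner) points, it is regular
in the sense of `IsOutwardNormal`. -/
def HasPiecewiseC1Boundary (C : Set Plane) : Prop :=
  ∃ F : Set Plane, F.Finite ∧ ∀ x ∈ frontier C \ F, ∃ n : Plane, IsOutwardNormal C x n

/-- The leading edge (inflow boundary): the boundary points where the transport velocity `V` points
strictly inwards, `V · n < 0`. -/
def leadingEdge (C : Set Plane) (V : Plane → Plane) : Set Plane :=
  {x ∈ frontier C | ∃ n : Plane, IsOutwardNormal C x n ∧ inner ℝ (V x) n < 0}

/-! ### Sobolev functions on the interior of the contact area -/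

/-- The Hilbert space `L²(int C; ℝ²)`. -/
abbrev L2 (C : Set Plane) : Type := Lp Plane 2 ((volume : Measure Plane).restrict (interior C))

/-- The partial derivative of a scalar test function in the direction of the `i`-th axis. -/
def testPartial (i : Fin 2) (φ : Plane → ℝ) (x : Plane) : ℝ :=
  fderiv ℝ φ x (EuclideanSpace.single i 1)

/-- `D 0` and `D 1` are the weak partial derivatives of `u` in the interior of `C`. Hence
`u ∈ H¹(int C; ℝ²)` means that `HasWeakPartials C u D` for some `D 0, D 1 ∈ L²(int C; ℝ²)`. -/
def HasWeakPartials (C : Set Plane) (u : L2 C) (D : Fin 2 → L2 C) : Prop :=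
  ∀ φ : Plane → ℝ, ContDiff ℝ ∞ φ → HasCompactSupport φ → tsupport φ ⊆ interior C →
    ∀ i : Fin 2,
      ∫ x in interior C, testPartial i φ x • u x = -∫ x in interior C, φ x • D i x

/-- The `H¹` function `u` with weak partial derivatives `D 0, D 1` has zero trace on the part `Γ` of
the boundary of `C`. By Green's formula
`∫_C (∂ᵢφ u + φ ∂ᵢu) = ∫_{∂C} φ u nᵢ`, this says that the boundary integral is zero for all test
functions `φ` that vanish near the rest `∂C \ Γ` of the boundary. -/
def HasZeroTraceOn (C Γ : Set Plane) (u : L2 C) (D : Fin 2 → L2 C) : Prop :=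
  ∀ φ : Plane → ℝ, ContDiff ℝ ∞ φ → HasCompactSupport φ →
    Disjoint (tsupport φ) (frontier C \ Γ) →
    ∀ i : Fin 2, ∫ x in interior C, (testPartial i φ x • u x + φ x • D i x) = 0

/-- Admissible initial conditions: `z₀ ∈ H¹(int C; ℝ²)` with zero trace on the leading edge. -/
def IsAdmissibleIC (C : Set Plane) (V : Plane → Plane) (z₀ : L2 C) : Prop :=
  ∃ D : Fin 2 → L2 C, HasWeakPartials C z₀ D ∧ HasZeroTraceOn C (leadingEdge C V) z₀ D

/-- Classical solutions on `s ∈ [0, ∞)` of the linear transport problem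
`∂z/∂s + (V · ∇) z = A z + h` in `int C`, `z = 0` on the leading edge, `z(·, 0) = z₀`:
`z ∈ C¹([0, ∞); L²) ∩ C⁰([0, ∞); H¹)`. -/
structure IsClassicalSolution (C : Set Plane) (V : Plane → Plane)
    (A : Plane → ℝ → Matrix (Fin 2) (Fin 2) ℝ) (h : Plane → ℝ → Plane)
    (z₀ : L2 C) (z : ℝ → L2 C) : Prop where
  contDiffOn : ContDiffOn ℝ 1 z (Ici 0)
  equation : ∃ D : Fin 2 → ℝ → L2 C,
    (∀ i, ContinuousOn (D i) (Ici 0)) ∧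
    (∀ s : ℝ, 0 ≤ s → HasWeakPartials C (z s) (fun i => D i s)) ∧
    (∀ s : ℝ, 0 < s → HasZeroTraceOn C (leadingEdge C V) (z s) (fun i => D i s)) ∧
    (∀ s : ℝ, 0 < s → ∀ᵐ x ∂((volume : Measure Plane).restrict (interior C)),
      (deriv z s : L2 C) x + (V x 0 • D 0 s x + V x 1 • D 1 s x)
        = Matrix.toEuclideanLin (A x s) (z s x) + h x s)
  initial : z 0 = z₀

/-! ### The friction model -/

/-- A family of regularisations `N ε = ‖·‖_{2,ε}` of the Euclidean norm: continuous and nonnegative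
for `ε ≥ 0`, continuously differentiable for `ε > 0`, and equal to the Euclidean norm for `ε = 0`;
for instance `N ε y = √(‖y‖² + ε)`. -/
structure IsNormRegularisation (N : ℝ → Plane → ℝ) : Prop where
  zero : ∀ y, N 0 y = ‖y‖
  nonneg : ∀ ε, 0 ≤ ε → ∀ y, 0 ≤ N ε y
  continuous : ∀ ε, 0 ≤ ε → Continuous (N ε)
  contDiff : ∀ ε, 0 < ε → ContDiff ℝ 1 (N ε)

/-- The constitutive data of the friction model: the micro-stiffness matrix `Σ₀ ≻ 0`, the
micro-damping matrix `Σ₁ ⪰ 0`, the continuous friction matrix `M(·) ≻ 0` (all symmetric), and a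
regularised Euclidean norm with parameter `ε ≥ 0`. -/
structure FrictionData where
  Sig0 : Matrix (Fin 2) (Fin 2) ℝ
  Sig1 : Matrix (Fin 2) (Fin 2) ℝ
  M : Plane → Matrix (Fin 2) (Fin 2) ℝ
  regNorm : ℝ → Plane → ℝ
  eps : ℝ
  posDef_Sig0 : Sig0.PosDef
  posSemidef_Sig1 : Sig1.PosSemidef
  continuous_M : Continuous M
  posDef_M : ∀ y, (M y).PosDef
  isNormRegularisation : IsNormRegularisation regNorm
  eps_nonneg : 0 ≤ eps

namespace FrictionData

variable (P : FrictionData)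

/-- `‖M(y) y‖_{2,ε}`. -/
def slipNorm (y : Plane) : ℝ := P.regNorm P.eps (Matrix.toEuclideanLin (P.M y) y)

/-- `G(y) = ‖M(y) y‖_{2,ε} Σ₁ + M(y)²`. -/
def G (y : Plane) : Matrix (Fin 2) (Fin 2) ℝ := P.slipNorm y • P.Sig1 + P.M y ^ 2

/-- `Σ = -(1/V_r) ‖M(V_r v) V_r v‖_{2,ε} G(V_r v)⁻¹ Σ₀`, for a nondimensional velocity `v` and the
current value `Vr` of the rolling speed. -/
def SigMat (Vr : ℝ) (v : Plane) : Matrix (Fin 2) (Fin 2) ℝ :=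
  -((1 / Vr * P.slipNorm (Vr • v)) • ((P.G (Vr • v))⁻¹ * P.Sig0))

/-- `H = -G(V_r v)⁻¹ M(V_r v)²`. -/
def HMat (Vr : ℝ) (v : Plane) : Matrix (Fin 2) (Fin 2) ℝ :=
  -((P.G (Vr • v))⁻¹ * P.M (Vr • v) ^ 2)

/-- `h = H v`. -/
def hVec (Vr : ℝ) (v : Plane) : Plane := Matrix.toEuclideanLin (P.HMat Vr v) v

end FrictionData

/-- The spin matrix `[0, -φ; φ, 0]`. -/
def spinMatrix (φ : ℝ) : Matrix (Fin 2) (Fin 2) ℝ := !![0, -φ; φ, 0]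

/-- The transport velocity `(-1, 0)` of the standard linear model. -/
def standardVelocity : Plane → Plane := fun _ => !₂[-1, 0]

/-- The transport velocity `-(ε_y, -ε_x) + [0, φ₁; -φ₁, 0] x` of the linear large-spin model. -/
def spinVelocity (e : Plane) (φ₁ : ℝ) : Plane → Plane := fun x =>
  -!₂[e 1, -e 0] + Matrix.toEuclideanLin !![0, φ₁; -φ₁, 0] x

/-! ### Inputs -/

/-- `‖v‖_∞`, the essential supremum of the Euclidean norm of `v` over `C × [0, ∞)`. -/
def slipSup (C : Set Plane) (v : Plane → ℝ → Plane) : ℝ :=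
  (eLpNorm (Function.uncurry v) ⊤ ((volume : Measure (Plane × ℝ)).restrict (C ×ˢ Ici 0))).toReal

/-- Rigid slip velocities `v ∈ C¹(C × [0, ∞); ℝ²) ∩ L^∞(C × [0, ∞); ℝ²)`. -/
def IsSlipInput (C : Set Plane) (v : Plane → ℝ → Plane) : Prop :=
  ContDiffOn ℝ 1 (Function.uncurry v) (C ×ˢ Ici 0) ∧
  MemLp (Function.uncurry v) ⊤ ((volume : Measure (Plane × ℝ)).restrict (C ×ˢ Ici 0))

/-- Rolling speeds `V_r ∈ C¹([0, ∞); [V_min, V_max])`. -/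
def IsRollingSpeed (Vmin Vmax : ℝ) (Vr : ℝ → ℝ) : Prop :=
  ContDiffOn ℝ 1 Vr (Ici 0) ∧ ∀ s : ℝ, 0 ≤ s → Vr s ∈ Icc Vmin Vmax

/-! ### The two models and input-to-state stability -/

/-- Classical solutions of the standard linear model
`∂z/∂s - ∂z/∂x = Σ(v, s) z + h(v, s)`. -/
def IsStandardSolution (P : FrictionData) (C : Set Plane) (v : Plane → ℝ → Plane) (Vr : ℝ → ℝ)
    (z₀ : L2 C) (z : ℝ → L2 C) : Prop :=
  IsClassicalSolution C standardVelocity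
    (fun x s => P.SigMat (Vr s) (v x s)) (fun x s => P.hVec (Vr s) (v x s)) z₀ z

/-- Classical solutions of the linear model for large spin slips
`∂z/∂s + (V · ∇) z = (Σ(v, s) - H(v, s) A_{φ₂}(s)) z + h(v, s)`. -/
def IsLargeSpinSolution (P : FrictionData) (C : Set Plane) (e : Plane) (φ₁ : ℝ) (φ₂ : ℝ → ℝ)
    (v : Plane → ℝ → Plane) (Vr : ℝ → ℝ) (z₀ : L2 C) (z : ℝ → L2 C) : Prop :=
  IsClassicalSolution C (spinVelocity e φ₁)
    (fun x s => P.SigMat (Vr s) (v x s) - P.HMat (Vr s) (v x s) * spinMatrix (φ₂ s))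
    (fun x s => P.hVec (Vr s) (v x s)) z₀ z

/-- Uniform input-to-state stability of the standard linear model in the spatial `L²` norm: the same
`β` and `γ` serve all slip velocities, rolling speeds and initial conditions. -/
def StandardModelISS (P : FrictionData) (C : Set Plane) (Vmin Vmax : ℝ) : Prop :=
  ∃ (β : ℝ → ℝ → ℝ) (γ : ℝ → ℝ), IsClassKL β ∧ IsClassKInf γ ∧
    ∀ (v : Plane → ℝ → Plane) (Vr : ℝ → ℝ) (z₀ : L2 C) (z : ℝ → L2 C),
      IsSlipInput C v → IsRollingSpeed Vmin Vmax Vr →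
      IsAdmissibleIC C standardVelocity z₀ →
      IsStandardSolution P C v Vr z₀ z →
      ∀ s : ℝ, 0 ≤ s → ‖z s‖ ≤ β ‖z₀‖ s + γ (slipSup C v)

/-- Uniform input-to-state stability of the linear model for large spin slips in the spatial `L²`
norm: for every bound `Φ` on the bounded spin `φ₂ ∈ C¹([0, ∞); ℝ)`, the same `β` and `γ` serve all
such spins and all slip velocities, rolling speeds and initial conditions. -/
def LargeSpinModelISS (P : FrictionData) (C : Set Plane) (Vmin Vmax : ℝ) (e : Plane) (φ₁ : ℝ) :
    Prop :=
  ∀ Φ : ℝ, ∃ (β : ℝ → ℝ → ℝ) (γ : ℝ → ℝ), IsClassKL β ∧ IsClassKInf γ ∧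
    ∀ (v : Plane → ℝ → Plane) (Vr φ₂ : ℝ → ℝ) (z₀ : L2 C) (z : ℝ → L2 C),
      IsSlipInput C v → IsRollingSpeed Vmin Vmax Vr →
      ContDiffOn ℝ 1 φ₂ (Ici 0) → (∀ s : ℝ, 0 ≤ s → |φ₂ s| ≤ Φ) →
      IsAdmissibleIC C (spinVelocity e φ₁) z₀ →
      IsLargeSpinSolution P C e φ₁ φ₂ v Vr z₀ z →
      ∀ s : ℝ, 0 ≤ s → ‖z s‖ ≤ β ‖z₀‖ s + γ (slipSup C v)

end

/-! The decay comes from transport alone: every characteristic leaves the bounded set `C` at a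
uniform rate. If `a` satisfies `⟨a, V⟩ ≤ -1` on `C`, then the weight `p = exp (c⟨a, x⟩)` decreases
along `V`, and in the energy `E = ∫ p ⟨z, Σ₀ z⟩` the transport term produces `-c E` minus an outflow
integral. The inner product of `Σ₀` makes the friction matrix `Σ = -κ G⁻¹ Σ₀`, `κ ≥ 0`, dissipative,
since `⟨w, Σ₀ Σ w⟩ = -κ ⟨Σ₀ w, G⁻¹ Σ₀ w⟩ ≤ 0`. The spin term and the forcing are bounded through the
size `R` of the input. Taking `c` large enough, depending on `R`, absorbs them and leaves `E' ≤ -2E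
+ k²` up to a constant factor of `k²`, so Grönwall's inequality gives exponential decay
(`IsClassicalSolution.norm_le`).

The overshoot then depends on `R`, so the estimate contains a product `K(R) ‖z₀‖ exp (-s)`. Young's
inequality splits it into a function of `(‖z₀‖, s)` and a function of `R` (`exists_gains`).

The analytic difficulty is the sign of the boundary term, as traces are known only through test
functions and the boundary has corners. A zero trace means that the extension by zero is weakly
differentiable across the inflow boundary, so a product rule shows that the quadratic form of `z`
has no flux there. Elsewhere the flux is nonnegative by interior cut-offs on strict outflow, by
perturbing `V` at tangential points, and by cut-offs constant along `V` at corners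
(`boundaryFlux_nonneg`, `weighted_transport_le`). -/

noncomputable section

/-! ### Weak directional derivatives of square integrable functions -/

/-- A sequence of bump functions with shrinking supports. -/
lemma exists_bump_seq (E : Type*) [NormedAddCommGroup E] [NormedSpace ℝ E]
    [HasContDiffBump E] : ∃ b : ℕ → ContDiffBump (0 : E),
    Tendsto (fun n => (b n).rOut) atTop (𝓝 0) := by
  refine ⟨fun n => ⟨1 / (2 * ((n : ℝ) + 1)), 1 / ((n : ℝ) + 1), by positivity, ?_⟩, ?_⟩
  · exact one_div_lt_one_div_of_lt (by positivity) (by nlinarith [n.cast_nonneg (α := ℝ)])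
  · exact tendsto_one_div_add_atTop_nhds_zero_nat

section WeakDerivative

open scoped Convolution

variable {E : Type*} [NormedAddCommGroup E] [InnerProductSpace ℝ E] [FiniteDimensional ℝ E]
  [MeasurableSpace E] [BorelSpace E]

lemma MeasureTheory.MemLp.integrable_fun_mul {α : Type*} {m : MeasurableSpace α}
    {μ : Measure α} {f g : α → ℝ} (hf : MemLp f 2 μ) (hg : MemLp g 2 μ) :
    Integrable (fun x => f x * g x) μ :=
  hf.integrable_mul hg

/-- On the open set `O`, the weak derivative of `f` in the direction `e` is `f'`. -/
def HasWeakDerivOn (O : Set E) (e : E) (f f' : E → ℝ) : Prop :=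
  ∀ φ : E → ℝ, ContDiff ℝ ∞ φ → HasCompactSupport φ → tsupport φ ⊆ O →
    ∫ x, (fderiv ℝ φ x e * f x + φ x * f' x) = 0

/-- Mollification with the normalised bump function `b`. -/
def mollify (b : ContDiffBump (0 : E)) (g : E → ℝ) : E → ℝ :=
  b.normed volume ⋆[ContinuousLinearMap.lsmul ℝ ℝ, volume] g

lemma mollify_apply (b : ContDiffBump (0 : E)) (g : E → ℝ) (x : E) :
    mollify b g x = ∫ t, b.normed volume t * g (x - t) := rfl

/-- Translations act continuously on `L²`, and the integral is the inner product of `k` with a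
translate of `g`. -/
lemma continuous_integral_mul_comp_sub {k g : E → ℝ} (hk : MemLp k 2) (hg : MemLp g 2) :
    Continuous fun t : E => ∫ x, k x * g (x - t) := by
  have hmp : ∀ t : E, MeasurePreserving (fun x : E => x - t) := fun t =>
    measurePreserving_sub_right volume t
  let T : C(E, C(E, E)) := (ContinuousMap.mk (fun a : E × E => a.2 - a.1) (by fun_prop)).curry
  have hc : Continuous fun t : E =>
      Lp.compMeasurePreserving (μ := volume) (μb := volume) (T t) (hmp t) (hg.toLp g) :=
    continuous_const.compMeasurePreservingLp T.continuous hmp (by simp)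
  have : (fun t : E => ∫ x, k x * g (x - t)) = fun t : E =>
      inner ℝ (hk.toLp k)
        (Lp.compMeasurePreserving (μ := volume) (μb := volume) (T t) (hmp t) (hg.toLp g)) := by
    funext t
    rw [L2.inner_def]
    refine integral_congr_ae ?_
    filter_upwards [hk.coeFn_toLp, Lp.coeFn_compMeasurePreserving (hg.toLp g) (hmp t),
      (hmp t).quasiMeasurePreserving.ae_eq_comp hg.coeFn_toLp] with x h1 h2 h3
    have h4 : (Lp.compMeasurePreserving (μ := volume) (μb := volume) (T t) (hmp t) (hg.toLp g)) x
        = g (x - t) := h2.trans h3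
    rw [h1, h4]
    simp [mul_comm]
  rw [this]
  exact continuous_const.inner hc

/-- By Fubini, pairing with a mollification averages the pairings with translates. Their continuity
in `t` therefore gives weak convergence. -/
lemma integral_mul_mollify {k g : E → ℝ} (hk : MemLp k 2) (hg : MemLp g 2)
    (b : ContDiffBump (0 : E)) :
    ∫ x, k x * mollify b g x = ∫ t, b.normed volume t * ∫ x, k x * g (x - t) := by
  have hint : Integrable (fun p : E × E => k p.1 * (b.normed volume p.2 * g (p.1 - p.2)))
      ((volume : Measure E).prod volume) := by
    have h1 : Integrable (fun p : E × E => (k p.1) ^ 2 * b.normed volume p.2)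
        ((volume : Measure E).prod volume) := hk.integrable_sq.mul_prod b.integrable_normed
    have h2 : Integrable (fun p : E × E => b.normed volume p.2 * g (p.1 - p.2) ^ 2)
        ((volume : Measure E).prod volume) :=
      (b.integrable_normed (μ := volume)).convolution_integrand (ContinuousLinearMap.lsmul ℝ ℝ)
        hg.integrable_sq
    have hm : AEStronglyMeasurable (fun p : E × E => b.normed volume p.2 * g (p.1 - p.2))
        ((volume : Measure E).prod volume) :=
      (b.integrable_normed (μ := volume)).aestronglyMeasurable.convolution_integrand
        (ContinuousLinearMap.lsmul ℝ ℝ) hg.aestronglyMeasurable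
    -- Domination by AM-GM: `|k b g| ≤ k² b + b g²`.
    refine (h1.add h2).mono' (hk.aestronglyMeasurable.comp_fst.mul hm) ?_
    refine Eventually.of_forall fun p => ?_
    have hb := b.nonneg_normed (μ := volume) p.2
    simp only [Pi.add_apply, Real.norm_eq_abs, abs_mul, abs_of_nonneg hb]
    have := two_mul_le_add_sq |k p.1| |g (p.1 - p.2)|
    rw [sq_abs, sq_abs] at this
    have h0 : 0 ≤ |k p.1| * |g (p.1 - p.2)| := by positivity
    nlinarith [mul_le_mul_of_nonneg_left this hb, mul_nonneg hb h0]
  calc ∫ x, k x * mollify b g x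
      = ∫ x, ∫ t, k x * (b.normed volume t * g (x - t)) := by
        simp_rw [mollify_apply, integral_const_mul]
    _ = ∫ t, ∫ x, k x * (b.normed volume t * g (x - t)) := integral_integral_swap hint
    _ = _ := by
        simp_rw [← integral_const_mul]
        congr! 4
        ring

/-- Mollifications converge weakly in `L²`. -/
lemma tendsto_integral_mul_mollify {k g : E → ℝ} (hk : MemLp k 2) (hg : MemLp g 2)
    {b : ℕ → ContDiffBump (0 : E)} (hb : Tendsto (fun n => (b n).rOut) atTop (𝓝 0)) :
    Tendsto (fun n => ∫ x, k x * mollify (b n) g x) atTop (𝓝 (∫ x, k x * g x)) := by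
  have hc := continuous_integral_mul_comp_sub hk hg
  -- A convolution at `0` evaluates its second factor at `-t`, hence the reflection.
  have hc' : Continuous fun t : E => ∫ x, k x * g (x - (-t)) := hc.comp continuous_neg
  have := ContDiffBump.convolution_tendsto_right_of_continuous (μ := volume) hb hc' 0
  simp only [neg_zero, sub_zero] at this
  refine this.congr fun n => ?_
  rw [integral_mul_mollify hk hg]
  simp [convolution_def, sub_eq_add_neg]

lemma contDiff_mollify {g : E → ℝ} (hg : LocallyIntegrable g) (b : ContDiffBump (0 : E)) :
    ContDiff ℝ ∞ (mollify b g) :=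
  b.hasCompactSupport_normed.contDiff_convolution_left _ b.contDiff_normed hg

/-- The defining identity of weak derivatives extends to `C¹` test functions. -/
lemma HasWeakDerivOn.integral_eq_zero {O : Set E} {e : E} {f f' : E → ℝ}
    (h : HasWeakDerivOn O e f f') (hO : IsOpen O) (hf : MemLp f 2) (hf' : MemLp f' 2)
    {φ : E → ℝ} (hφ : ContDiff ℝ 1 φ) (hφc : HasCompactSupport φ) (hφO : tsupport φ ⊆ O) :
    ∫ x, (fderiv ℝ φ x e * f x + φ x * f' x) = 0 := by
  obtain ⟨b, hb⟩ := exists_bump_seq E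
  obtain ⟨δ, hδ, hδO⟩ := hφc.isCompact.exists_cthickening_subset_open hO hφO
  -- The test function is mollified and `f` is left alone. The margin `δ` keeps the enlarged support
  -- inside `O`, and weak convergence passes to the limit.
  have hφ2 : MemLp φ 2 := hφ.continuous.memLp_of_hasCompactSupport hφc
  have hdc : Continuous fun x => fderiv ℝ φ x e :=
    (hφ.continuous_fderiv one_ne_zero).clm_apply continuous_const
  have hds : HasCompactSupport fun x => fderiv ℝ φ x e := hφc.fderiv_apply ℝ e
  have hd2 : MemLp (fun x => fderiv ℝ φ x e) 2 := hdc.memLp_of_hasCompactSupport hds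
  have hder : ∀ n x, fderiv ℝ (mollify (b n) φ) x e
      = mollify (b n) (fun x => fderiv ℝ φ x e) x := by
    intro n x
    have hloc : LocallyIntegrable ((b n).normed volume) volume :=
      ((b n).integrable_normed (μ := volume)).locallyIntegrable
    have := hφc.hasFDerivAt_convolution_right (ContinuousLinearMap.lsmul ℝ ℝ) hloc hφ x
    rw [mollify, this.fderiv, convolution_precompR_apply _ hloc (hφc.fderiv ℝ)
      (hφ.continuous_fderiv one_ne_zero)]
    rfl
  have hlim := (tendsto_integral_mul_mollify hf hd2 hb).add
    (tendsto_integral_mul_mollify hf' hφ2 hb)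
  have hev : ∀ᶠ n in atTop, (∫ x, f x * mollify (b n) (fun x => fderiv ℝ φ x e) x)
      + ∫ x, f' x * mollify (b n) φ x = 0 := by
    filter_upwards [hb.eventually (gt_mem_nhds hδ)] with n hn
    have hsupp : tsupport (mollify (b n) φ) ⊆ Metric.cthickening δ (tsupport φ) := by
      refine closure_minimal ?_ Metric.isClosed_cthickening
      refine (support_convolution_subset_swap _).trans ?_
      rintro _ ⟨x, hx, y, hy, rfl⟩
      rw [(b n).support_normed_eq] at hy
      refine Metric.mem_cthickening_of_dist_le _ x _ _ (subset_tsupport _ hx) ?_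
      simp only [Metric.mem_ball, dist_zero_right] at hy
      simpa using (hy.trans hn).le
    have hcs : HasCompactSupport (mollify (b n) φ) :=
      HasCompactSupport.intro' hφc.isCompact.cthickening Metric.isClosed_cthickening
        fun x hx => image_eq_zero_of_notMem_tsupport fun hx' => hx (hsupp hx')
    have hcd := contDiff_mollify (hφ2.locallyIntegrable (by norm_num)) (b n)
    have h0 := h _ hcd hcs (hsupp.trans hδO)
    have hm2 : MemLp (mollify (b n) φ) 2 := hcd.continuous.memLp_of_hasCompactSupport hcs
    have hmd2 : MemLp (fun x => fderiv ℝ (mollify (b n) φ) x e) 2 :=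
      ((hcd.continuous_fderiv (by simp)).clm_apply continuous_const).memLp_of_hasCompactSupport
        (hcs.fderiv_apply ℝ e)
    rw [integral_add (hmd2.integrable_fun_mul hf) (hm2.integrable_fun_mul hf')] at h0
    rw [← h0]
    congr 1
    · simp_rw [hder, mul_comm]
    · simp_rw [mul_comm]
  have := tendsto_nhds_unique hlim (tendsto_const_nhds.congr' (hev.mono fun n hn => hn.symm))
  rw [integral_add (hd2.integrable_fun_mul hf) (hφ2.integrable_fun_mul hf')]
  rw [← this]
  congr 1
  · simp_rw [mul_comm]
  · simp_rw [mul_comm]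

/-- The derivative falls on the kernel, and the reflected kernel `y ↦ b (x - y)` is itself an
admissible test function because its support lies in the ball around `x`. -/
lemma HasWeakDerivOn.fderiv_mollify {O : Set E} {e : E} {g g' : E → ℝ}
    (h : HasWeakDerivOn O e g g') (hg : MemLp g 2) (hg' : MemLp g' 2)
    (b : ContDiffBump (0 : E)) {x : E} (hx : Metric.closedBall x b.rOut ⊆ O) :
    fderiv ℝ (mollify b g) x e = mollify b g' x := by
  have hloc := hg.locallyIntegrable (by norm_num)
  have hbc : HasCompactSupport (b.normed (volume : Measure E)) := b.hasCompactSupport_normed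
  have hb1 : ContDiff ℝ 1 (b.normed (volume : Measure E)) := b.contDiff_normed
  have hd := hbc.hasFDerivAt_convolution_left (ContinuousLinearMap.lsmul ℝ ℝ) hb1 hloc x
  have hex := (hbc.fderiv ℝ).convolutionExists_left
    ((ContinuousLinearMap.lsmul ℝ ℝ).precompL E : (E →L[ℝ] ℝ) →L[ℝ] ℝ →L[ℝ] (E →L[ℝ] ℝ))
    (hb1.continuous_fderiv one_ne_zero) hloc x
  have h1 : fderiv ℝ (mollify b g) x e
      = ∫ t, fderiv ℝ (b.normed (volume : Measure E)) t e * g (x - t) := by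
    rw [mollify, hd.fderiv, convolution_def, ContinuousLinearMap.integral_apply hex]
    rfl
  set φ : E → ℝ := fun y => b.normed volume (x - y) with hφ
  have hφd : ContDiff ℝ ∞ φ := b.contDiff_normed.comp (contDiff_const.sub contDiff_id)
  have hφs : tsupport φ ⊆ Metric.closedBall x b.rOut := by
    refine closure_minimal (fun y hy => ?_) Metric.isClosed_closedBall
    have : x - y ∈ Function.support (b.normed (volume : Measure E)) := hy
    rw [b.support_normed_eq, Metric.mem_ball, dist_zero_right] at this
    rw [Metric.mem_closedBall, dist_comm, dist_eq_norm]
    exact this.le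
  have hφc : HasCompactSupport φ :=
    HasCompactSupport.intro' (isCompact_closedBall x b.rOut) Metric.isClosed_closedBall
      fun y hy => image_eq_zero_of_notMem_tsupport fun hy' => hy (hφs hy')
  have hfd : ∀ y, fderiv ℝ φ y e = -fderiv ℝ (b.normed (volume : Measure E)) (x - y) e := by
    intro y
    have h2 : HasFDerivAt (fun y : E => x - y) (-ContinuousLinearMap.id ℝ E) y :=
      (hasFDerivAt_id y).const_sub x
    have h3 := ((hb1.differentiable one_ne_zero) (x - y)).hasFDerivAt.comp y h2
    have : fderiv ℝ φ y = _ := h3.fderiv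
    rw [this]; simp
  have h0 := h φ hφd hφc (hφs.trans hx)
  have hd2 : MemLp (fun y => fderiv ℝ φ y e) 2 :=
    ((hφd.continuous_fderiv (by simp)).clm_apply continuous_const).memLp_of_hasCompactSupport
      (hφc.fderiv_apply ℝ e)
  have hφ2 : MemLp φ 2 := hφd.continuous.memLp_of_hasCompactSupport hφc
  rw [integral_add (hd2.integrable_fun_mul hg) (hφ2.integrable_fun_mul hg')] at h0
  rw [h1, mollify_apply,
    ← integral_sub_left_eq_self (fun t => b.normed volume t * g' (x - t)) volume x,
    ← integral_sub_left_eq_self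
      (fun t => fderiv ℝ (b.normed (volume : Measure E)) t e * g (x - t)) volume x]
  simp only [sub_sub_cancel]
  simp_rw [hfd, neg_mul, integral_neg] at h0
  linarith

/-- The product rule for weak derivatives. -/
lemma HasWeakDerivOn.integral_mul_eq_zero {O : Set E} {e : E} {f f' g g' : E → ℝ}
    (hf : HasWeakDerivOn O e f f') (hg : HasWeakDerivOn O e g g') (hO : IsOpen O)
    (hf2 : MemLp f 2) (hf2' : MemLp f' 2) (hg2 : MemLp g 2) (hg2' : MemLp g' 2)
    {ψ : E → ℝ} (hψ : ContDiff ℝ 1 ψ) (hψc : HasCompactSupport ψ) (hψO : tsupport ψ ⊆ O) :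
    ∫ x, (fderiv ℝ ψ x e * (f x * g x) + ψ x * (f' x * g x + f x * g' x)) = 0 := by
  obtain ⟨b, hb⟩ := exists_bump_seq E
  obtain ⟨δ, hδ, hδO⟩ := hψc.isCompact.exists_cthickening_subset_open hO hψO
  have hloc := hg2.locallyIntegrable (by norm_num)
  have bdd : ∀ {w k : E → ℝ}, Continuous w → HasCompactSupport w → MemLp k 2 →
      MemLp (fun x => w x * k x) 2 := by
    intro w k hw hwc hk
    have : MemLp w ⊤ := hw.memLp_of_hasCompactSupport hwc
    exact hk.mul this
  have hdc : Continuous fun x => fderiv ℝ ψ x e :=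
    (hψ.continuous_fderiv one_ne_zero).clm_apply continuous_const
  have hA := bdd hdc (hψc.fderiv_apply ℝ e) hf2
  have hB := bdd hψ.continuous hψc hf2
  have hC := bdd hψ.continuous hψc hf2'
  -- Only `g` is mollified, so that `ψ` times its mollification is a `C¹` test function for `f`. In
  -- every term the mollified factor is paired with a fixed `L²` function, so weak convergence
  -- suffices.
  have hlim := ((tendsto_integral_mul_mollify hA hg2 hb).add
    (tendsto_integral_mul_mollify hB hg2' hb)).add (tendsto_integral_mul_mollify hC hg2 hb)
  have hev : ∀ᶠ n in atTop, (∫ x, (fderiv ℝ ψ x e * f x) * mollify (b n) g x)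
      + (∫ x, (ψ x * f x) * mollify (b n) g' x)
      + ∫ x, (ψ x * f' x) * mollify (b n) g x = 0 := by
    filter_upwards [hb.eventually (gt_mem_nhds hδ)] with n hn
    have hcd : ContDiff ℝ 1 (mollify (b n) g) := (contDiff_mollify hloc (b n)).of_le (by simp)
    have h0 := hf.integral_eq_zero hO hf2 hf2' (φ := fun x => ψ x * mollify (b n) g x)
      (hψ.mul hcd) (hψc.mul_right) ((tsupport_mul_subset_left).trans hψO)
    have hpt : ∀ x, fderiv ℝ (fun x => ψ x * mollify (b n) g x) x e * f x
        + ψ x * mollify (b n) g x * f' x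
        = (fderiv ℝ ψ x e * mollify (b n) g x) * f x
          + (ψ x * fderiv ℝ (mollify (b n) g) x e) * f x + ψ x * mollify (b n) g x * f' x := by
      intro x
      rw [fderiv_fun_mul (hψ.differentiable one_ne_zero x) (hcd.differentiable one_ne_zero x)]
      simp only [_root_.add_apply, _root_.smul_apply, smul_eq_mul]
      ring
    simp_rw [hpt] at h0
    have i1 : MemLp (fun x => fderiv ℝ ψ x e * mollify (b n) g x) 2 :=
      (hdc.mul hcd.continuous).memLp_of_hasCompactSupport (hψc.fderiv_apply ℝ e).mul_right
    have i2 : MemLp (fun x => ψ x * fderiv ℝ (mollify (b n) g) x e) 2 :=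
      (hψ.continuous.mul ((hcd.continuous_fderiv one_ne_zero).clm_apply
        continuous_const)).memLp_of_hasCompactSupport hψc.mul_right
    have i3 : MemLp (fun x => ψ x * mollify (b n) g x) 2 :=
      (hψ.continuous.mul hcd.continuous).memLp_of_hasCompactSupport hψc.mul_right
    rw [integral_add ((i1.integrable_fun_mul hf2).fun_add (i2.integrable_fun_mul hf2))
      (i3.integrable_fun_mul hf2'), integral_add (i1.integrable_fun_mul hf2)
      (i2.integrable_fun_mul hf2)] at h0
    rw [← h0]
    congr 2
    · congr! 2 with x; ring
    · refine integral_congr_ae (Eventually.of_forall fun x => ?_)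
      by_cases hx : x ∈ tsupport ψ
      · have hball : Metric.closedBall x (b n).rOut ⊆ O := fun y hy =>
          hδO (Metric.mem_cthickening_of_dist_le y x _ _ hx
            ((Metric.mem_closedBall.1 hy).trans hn.le))
        simp only [hg.fderiv_mollify hg2 hg2' (b n) hball]
        ring
      · simp [image_eq_zero_of_notMem_tsupport hx]
    · funext x; ring
  have hu := tendsto_nhds_unique hlim (tendsto_const_nhds.congr' (hev.mono fun n hn => hn.symm))
  rw [← hu, ← integral_add (hA.integrable_fun_mul hg2) (hB.integrable_fun_mul hg2'),
    ← integral_add ((hA.integrable_fun_mul hg2).fun_add (hB.integrable_fun_mul hg2'))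
      (hC.integrable_fun_mul hg2)]
  congr! 2 with x
  ring

end WeakDerivative

/-! ### Quadratic expressions in Sobolev functions and their boundary flux -/

/-- The bilinear form `⟨a, S b⟩` of the matrix `S`. -/
def matForm (S : Matrix (Fin 2) (Fin 2) ℝ) (a b : Plane) : ℝ :=
  inner ℝ a (Matrix.toEuclideanLin S b)

lemma matForm_eq_sum (S : Matrix (Fin 2) (Fin 2) ℝ) (a b : Plane) :
    matForm S a b = ∑ p : Fin 2 × Fin 2, S p.1 p.2 * (a p.1 * b p.2) := by
  simp only [matForm, PiLp.inner_apply, Matrix.ofLp_toLpLin, Matrix.toLin'_apply, Matrix.mulVec,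
    dotProduct, Fintype.sum_prod_type, Fin.sum_univ_two, RCLike.inner_apply, conj_trivial]
  ring

/-- The flux of `ψ q X` through the boundary of `C`, written as the integral over `int C` of the
divergence of `ψ q X`, where `q' 0` and `q' 1` are the partial derivatives of `q` and `X` is
divergence-free. -/
def boundaryFlux (C : Set Plane) (q : Plane → ℝ) (q' : Fin 2 → Plane → ℝ) (X : Plane → Plane)
    (ψ : Plane → ℝ) : ℝ :=
  ∫ x in interior C,
    (fderiv ℝ ψ x (X x) * q x + ψ x * (X x 0 * q' 0 x + X x 1 * q' 1 x))

/-- `C¹` vector fields whose `i`-th component does not depend on the `i`-th coordinate. -/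
structure IsTransportField (X : Plane → Plane) : Prop where
  contDiff : ContDiff ℝ 1 X
  fderiv_diag : ∀ i x, fderiv ℝ (fun y => X y i) x (EuclideanSpace.single i 1) = 0

lemma contDiff_coord {n : WithTop ℕ∞} {X : Plane → Plane} (hX : ContDiff ℝ n X) (i : Fin 2) :
    ContDiff ℝ n fun x => X x i :=
  (EuclideanSpace.proj (𝕜 := ℝ) i).contDiff.comp hX

lemma IsTransportField.add_const {X : Plane → Plane} (hX : IsTransportField X) (w : Plane) :
    IsTransportField fun x => X x + w := by
  refine ⟨hX.contDiff.add contDiff_const, fun i x => ?_⟩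
  simp only [PiLp.add_apply, fderiv_add_const]
  exact hX.fderiv_diag i x

/-- `q` has no boundary flux through the part `Γ` of the boundary of `C`, for test functions that
vanish near the rest of the boundary. -/
def HasNoFluxOn (C Γ : Set Plane) (q : Plane → ℝ) (q' : Fin 2 → Plane → ℝ) : Prop :=
  ∀ O : Set Plane, IsOpen O → Disjoint O (frontier C \ Γ) → ∀ ψ : Plane → ℝ, ContDiff ℝ 1 ψ →
    HasCompactSupport ψ → tsupport ψ ⊆ O → ∀ i : Fin 2,
      ∫ x in interior C, (testPartial i ψ x * q x + ψ x * q' i x) = 0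

lemma plane_eq_sum (v : Plane) :
    v = v 0 • EuclideanSpace.single 0 (1 : ℝ) + v 1 • EuclideanSpace.single 1 (1 : ℝ) := by
  ext i
  fin_cases i <;> simp

lemma integrable_continuous_mul {C : Set Plane} (hC : IsCompact C) {w f : Plane → ℝ}
    (hw : Continuous w) (hf : IntegrableOn f (interior C)) :
    IntegrableOn (fun x => w x * f x) (interior C) := by
  obtain ⟨c, hc⟩ := hC.exists_bound_of_continuousOn hw.continuousOn
  refine hf.bdd_mul (c := c) hw.aestronglyMeasurable ?_
  filter_upwards [ae_restrict_mem isOpen_interior.measurableSet] with x hx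
  exact hc x (interior_subset hx)

lemma integrable_boundaryFlux {C : Set Plane} (hC : IsCompact C) {q : Plane → ℝ}
    {q' : Fin 2 → Plane → ℝ} (hq : IntegrableOn q (interior C))
    (hq' : ∀ i, IntegrableOn (q' i) (interior C)) {X : Plane → Plane} (hX : Continuous X)
    {ψ : Plane → ℝ} (hψ : ContDiff ℝ 1 ψ) :
    IntegrableOn (fun x => fderiv ℝ ψ x (X x) * q x
      + ψ x * (X x 0 * q' 0 x + X x 1 * q' 1 x)) (interior C) := by
  have hXi : ∀ i, Continuous fun x => X x i := fun i =>
    (EuclideanSpace.proj (𝕜 := ℝ) i).continuous.comp hX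
  refine (integrable_continuous_mul hC
    ((hψ.continuous_fderiv one_ne_zero).clm_apply hX) hq).fun_add
    (integrable_continuous_mul hC hψ.continuous ?_)
  exact (integrable_continuous_mul hC (hXi 0) (hq' 0)).fun_add
    (integrable_continuous_mul hC (hXi 1) (hq' 1))

/-- The coordinate identities are applied to `ψ X₀` and `ψ X₁` and added. Since `∂ᵢ Xᵢ = 0`, no
derivative of `X` survives. -/
lemma HasNoFluxOn.boundaryFlux_eq_zero {C Γ : Set Plane} (hC : IsCompact C) {q : Plane → ℝ}
    {q' : Fin 2 → Plane → ℝ} (h : HasNoFluxOn C Γ q q') (hq : IntegrableOn q (interior C))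
    (hq' : ∀ i, IntegrableOn (q' i) (interior C)) {X : Plane → Plane} (hX : IsTransportField X)
    {O : Set Plane} (hO : IsOpen O) (hOΓ : Disjoint O (frontier C \ Γ)) {ψ : Plane → ℝ}
    (hψ : ContDiff ℝ 1 ψ) (hψc : HasCompactSupport ψ) (hψO : tsupport ψ ⊆ O) :
    boundaryFlux C q q' X ψ = 0 := by
  have hcd : ∀ i : Fin 2, ContDiff ℝ 1 fun x => ψ x * X x i := fun i =>
    hψ.mul (contDiff_coord hX.contDiff i)
  have h0 : ∀ i : Fin 2, ∫ x in interior C, (testPartial i (fun x => ψ x * X x i) x * q x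
      + ψ x * X x i * q' i x) = 0 := fun i =>
    h O hO hOΓ _ (hcd i) hψc.mul_right (tsupport_mul_subset_left.trans hψO) i
  have hint : ∀ i : Fin 2, IntegrableOn (fun x => testPartial i (fun x => ψ x * X x i) x * q x
      + ψ x * X x i * q' i x) (interior C) := fun i =>
    (integrable_continuous_mul hC (((hcd i).continuous_fderiv one_ne_zero).clm_apply
      continuous_const) hq).fun_add (integrable_continuous_mul hC (hcd i).continuous (hq' i))
  have hsum := integral_add (hint 0) (hint 1)
  rw [h0, h0, add_zero] at hsum
  rw [boundaryFlux, ← hsum]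
  refine integral_congr_ae (Eventually.of_forall fun x => ?_)
  have hp : ∀ i : Fin 2, testPartial i (fun x => ψ x * X x i) x
      = X x i * testPartial i ψ x := fun i => by
    rw [testPartial, fderiv_fun_mul (hψ.differentiable one_ne_zero x)
      ((contDiff_coord hX.contDiff i).differentiable one_ne_zero x)]
    simp [hX.fderiv_diag, testPartial]
  have hd : fderiv ℝ ψ x (X x) = X x 0 * testPartial 0 ψ x + X x 1 * testPartial 1 ψ x := by
    conv_lhs => rw [plane_eq_sum (X x)]
    simp [testPartial]
  simp only [hp, hd]
  ring

lemma memLp_coord {C : Set Plane} (u : L2 C) (j : Fin 2) :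
    MemLp (fun x => u x j) 2 (volume.restrict (interior C)) :=
  (EuclideanSpace.proj (𝕜 := ℝ) j : Plane →L[ℝ] ℝ).comp_memLp' (Lp.memLp u)

lemma memLp_indicator_coord {C : Set Plane} (u : L2 C) (j : Fin 2) :
    MemLp ((interior C).indicator fun x => u x j) 2 :=
  (memLp_indicator_iff_restrict isOpen_interior.measurableSet).2 (memLp_coord u j)

lemma integrableOn_matForm {C : Set Plane} (S : Matrix (Fin 2) (Fin 2) ℝ) (u w : L2 C) :
    IntegrableOn (fun x => matForm S (u x) (w x)) (interior C) := by
  simp_rw [matForm_eq_sum]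
  exact integrable_finsetSum _ fun p _ =>
    ((memLp_coord u p.1).integrable_fun_mul (memLp_coord w p.2)).const_mul _

/-- The boundary disappears here: a zero trace on `Γ` says exactly that extension by zero creates no
singular part of the derivative across `Γ`. -/
lemma HasZeroTraceOn.hasWeakDerivOn {C Γ : Set Plane} {u : L2 C} {D : Fin 2 → L2 C}
    (h : HasZeroTraceOn C Γ u D) {O : Set Plane} (hO : Disjoint O (frontier C \ Γ))
    (i j : Fin 2) :
    HasWeakDerivOn O (EuclideanSpace.single i (1 : ℝ)) ((interior C).indicator fun x => u x j)
      ((interior C).indicator fun x => D i x j) := by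
  intro φ hφ hφc hφO
  have h0 := h φ hφ hφc (hO.mono_left hφO) i
  have hdc : Continuous (testPartial i φ) :=
    (hφ.continuous_fderiv (by simp)).clm_apply continuous_const
  have hint : ∀ {w : Plane → ℝ} (f : L2 C), Continuous w → HasCompactSupport w →
      IntegrableOn (fun x => w x • f x) (interior C) := fun f hw hwc =>
    memLp_one_iff_integrable.1 ((Lp.memLp f).smul
      ((hw.memLp_of_hasCompactSupport (p := 2) (μ := volume) hwc).restrict (interior C)))
  have hI := (hint u hdc (hφc.fderiv_apply ℝ _)).fun_add (hint (D i) hφ.continuous hφc)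
  have h1 := (EuclideanSpace.proj (𝕜 := ℝ) j : Plane →L[ℝ] ℝ).integral_comp_comm hI
  rw [h0, map_zero, ← integral_indicator isOpen_interior.measurableSet] at h1
  rw [← h1]
  refine integral_congr_ae (Eventually.of_forall fun x => ?_)
  by_cases hx : x ∈ interior C <;> simp [hx, testPartial]

/-- The product rule is applied to the zero extensions, entry by entry of `S`. These are weakly
differentiable on all of `O`, so no trace theory for the quadratic expression is needed. -/
lemma HasZeroTraceOn.hasNoFluxOn {C Γ : Set Plane} (hC : IsCompact C) {u : L2 C}
    {D : Fin 2 → L2 C} (h : HasZeroTraceOn C Γ u D) (S : Matrix (Fin 2) (Fin 2) ℝ) :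
    HasNoFluxOn C Γ (fun x => matForm S (u x) (u x))
      (fun i x => matForm S (D i x) (u x) + matForm S (u x) (D i x)) := by
  intro O hO hOΓ ψ hψ hψc hψO i
  have key : ∀ p : Fin 2 × Fin 2, ∫ x in interior C, (testPartial i ψ x * (u x p.1 * u x p.2)
      + ψ x * (D i x p.1 * u x p.2 + u x p.1 * D i x p.2)) = 0 := by
    intro p
    have := (h.hasWeakDerivOn hOΓ i p.1).integral_mul_eq_zero (h.hasWeakDerivOn hOΓ i p.2) hO
      (memLp_indicator_coord _ _) (memLp_indicator_coord _ _) (memLp_indicator_coord _ _)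
      (memLp_indicator_coord _ _) hψ hψc hψO
    rw [← integral_indicator isOpen_interior.measurableSet, ← this]
    refine integral_congr_ae (Eventually.of_forall fun x => ?_)
    by_cases hx : x ∈ interior C <;> simp [hx, testPartial]
  have hint : ∀ p : Fin 2 × Fin 2, IntegrableOn (fun x => testPartial i ψ x * (u x p.1 * u x p.2)
      + ψ x * (D i x p.1 * u x p.2 + u x p.1 * D i x p.2)) (interior C) := fun p =>
    (integrable_continuous_mul hC ((hψ.continuous_fderiv one_ne_zero).clm_apply continuous_const)
      ((memLp_coord u p.1).integrable_fun_mul (memLp_coord u p.2))).fun_add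
    (integrable_continuous_mul hC hψ.continuous
      (((memLp_coord (D i) p.1).integrable_fun_mul (memLp_coord u p.2)).fun_add
        ((memLp_coord u p.1).integrable_fun_mul (memLp_coord (D i) p.2))))
  calc _ = ∫ x in interior C, ∑ p : Fin 2 × Fin 2, S p.1 p.2 *
        (testPartial i ψ x * (u x p.1 * u x p.2)
          + ψ x * (D i x p.1 * u x p.2 + u x p.1 * D i x p.2)) := by
        refine integral_congr_ae (Eventually.of_forall fun x => ?_)
        simp only [matForm_eq_sum, Fintype.sum_prod_type, Fin.sum_univ_two]
        ring
    _ = 0 := by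
        rw [integral_finsetSum _ fun p _ => (hint p).const_mul _]
        simp_rw [integral_const_mul, key, mul_zero, Finset.sum_const_zero]

/-! ### Nonnegativity of the flux of a quantity that vanishes on the inflow boundary -/

section Flux

variable {C : Set Plane} {q : Plane → ℝ} {q' : Fin 2 → Plane → ℝ}

lemma boundaryFlux_sum (hC : IsCompact C) (hq : IntegrableOn q (interior C))
    (hq' : ∀ i, IntegrableOn (q' i) (interior C)) {X : Plane → Plane} (hX : Continuous X)
    {ι : Type*} (s : Finset ι) {ψ : ι → Plane → ℝ} (hψ : ∀ i, ContDiff ℝ 1 (ψ i)) :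
    boundaryFlux C q q' X (fun x => ∑ i ∈ s, ψ i x) = ∑ i ∈ s, boundaryFlux C q q' X (ψ i) := by
  simp only [boundaryFlux]
  rw [← integral_finsetSum _ fun i _ => integrable_boundaryFlux hC hq hq' hX (hψ i)]
  refine integral_congr_ae (Eventually.of_forall fun x => ?_)
  have : fderiv ℝ (fun x => ∑ i ∈ s, ψ i x) x = ∑ i ∈ s, fderiv ℝ (ψ i) x :=
    fderiv_fun_sum fun i _ => (hψ i).differentiable one_ne_zero x
  simp only [this, Finset.sum_add_distrib, Finset.sum_mul, _root_.sum_apply]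

lemma boundaryFlux_add_const (hC : IsCompact C) (hq : IntegrableOn q (interior C))
    (hq' : ∀ i, IntegrableOn (q' i) (interior C)) {X : Plane → Plane} (hX : Continuous X)
    (w : Plane) (κ : ℝ) {ψ : Plane → ℝ} (hψ : ContDiff ℝ 1 ψ) :
    boundaryFlux C q q' (fun x => X x + κ • w) ψ
      = boundaryFlux C q q' X ψ + κ * boundaryFlux C q q' (fun _ => w) ψ := by
  simp only [boundaryFlux]
  rw [← integral_const_mul, ← integral_add (integrable_boundaryFlux hC hq hq' hX hψ)
    ((integrable_boundaryFlux hC hq hq' continuous_const hψ).const_mul κ)]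
  refine integral_congr_ae (Eventually.of_forall fun x => ?_)
  simp only [map_add, map_smul, PiLp.add_apply, PiLp.smul_apply, smul_eq_mul]
  ring

/-- Nonnegativity of the flux is a local property. -/
lemma boundaryFlux_nonneg_of_local (hC : IsCompact C) (hq : IntegrableOn q (interior C))
    (hq' : ∀ i, IntegrableOn (q' i) (interior C)) {X : Plane → Plane} (hX : Continuous X)
    {ψ : Plane → ℝ} (hψ : ContDiff ℝ 1 ψ) (hψc : HasCompactSupport ψ) (hψ0 : ∀ x, 0 ≤ ψ x)
    (hloc : ∀ x ∈ tsupport ψ, ∃ U : Set Plane, IsOpen U ∧ x ∈ U ∧ ∀ χ : Plane → ℝ,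
      ContDiff ℝ 1 χ → HasCompactSupport χ → (∀ x, 0 ≤ χ x) → tsupport χ ⊆ U →
        0 ≤ boundaryFlux C q q' X χ) :
    0 ≤ boundaryFlux C q q' X ψ := by
  choose! U hUo hxU hU using hloc
  obtain ⟨t, ht, hcov⟩ := hψc.isCompact.elim_nhds_subcover U fun x hx =>
    (hUo x hx).mem_nhds (hxU x hx)
  obtain ⟨f, hf⟩ := SmoothPartitionOfUnity.exists_isSubordinate (modelWithCornersSelf ℝ Plane)
    (isClosed_tsupport ψ) (fun i : t => U i) (fun i => hUo i (ht i i.2))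
    (fun x hx => by
      obtain ⟨y, hy, hxy⟩ := mem_iUnion₂.1 (hcov hx)
      exact mem_iUnion.2 ⟨⟨y, hy⟩, hxy⟩)
  have hfc : ∀ i, ContDiff ℝ 1 fun x => f i x * ψ x := fun i =>
    ((f i).contMDiff.contDiff.of_le (by simp)).mul hψ
  have hdec : ψ = fun x => ∑ i, f i x * ψ x := by
    funext x
    by_cases hx : x ∈ tsupport ψ
    · have := f.sum_eq_one hx
      rw [finsum_eq_sum_of_fintype] at this
      rw [← Finset.sum_mul, this, one_mul]
    · simp [image_eq_zero_of_notMem_tsupport hx]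
  rw [hdec, boundaryFlux_sum hC hq hq' hX _ hfc]
  exact Finset.sum_nonneg fun i _ => hU i (ht i i.2) _ (hfc i) hψc.mul_left
    (fun x => mul_nonneg (f.nonneg i x) (hψ0 x)) (tsupport_mul_subset_left.trans (hf i))

lemma deriv_smoothTransition_nonneg (t : ℝ) : 0 ≤ deriv Real.smoothTransition t :=
  Real.smoothTransition.monotone.deriv_nonneg

/-- The test function is cut off by functions `θ n` of `g` that tend to `1` inside `C`. The cut-off
flux is zero, being supported in the interior, while the derivative of `θ n` along `X` is
nonpositive because `g` does not decrease along `X`. Dropping that term leaves a nonnegative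
integral, and `n → ∞` gives the claim. -/
lemma boundaryFlux_nonneg_of_outflow {Γ : Set Plane} (hC : IsCompact C)
    (h : HasNoFluxOn C Γ q q') (hq : IntegrableOn q (interior C))
    (hq' : ∀ i, IntegrableOn (q' i) (interior C)) (hq0 : ∀ x, 0 ≤ q x)
    {X : Plane → Plane} (hX : IsTransportField X)
    {U : Set Plane} (hU : IsOpen U) {g : Plane → ℝ} (hg : ContDiffOn ℝ 1 g U)
    (hCU : C ∩ U = {y ∈ U | g y ≤ 0}) (hg' : ∀ y ∈ U, fderiv ℝ g y ≠ 0)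
    (hgX : ∀ y ∈ U, 0 ≤ fderiv ℝ g y (X y))
    {ψ : Plane → ℝ} (hψ : ContDiff ℝ 1 ψ) (hψc : HasCompactSupport ψ) (hψ0 : ∀ x, 0 ≤ ψ x)
    (hψU : tsupport ψ ⊆ U) : 0 ≤ boundaryFlux C q q' X ψ := by
  have hgat : ∀ x ∈ U, ContDiffAt ℝ 1 g x := fun x hx => hg.contDiffAt (hU.mem_nhds hx)
  -- An interior zero of `g` would be a local maximum, hence a critical point.
  have hneg : ∀ x ∈ interior C, x ∈ U → g x < 0 := by
    intro x hx hxU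
    have hle : ∀ y ∈ interior C ∩ U, g y ≤ 0 := fun y hy => by
      have : y ∈ C ∩ U := ⟨interior_subset hy.1, hy.2⟩
      rw [hCU] at this
      exact this.2
    refine lt_of_le_of_ne (hle x ⟨hx, hxU⟩) fun h0 => hg' x hxU ?_
    have hmax : IsLocalMax g x := by
      filter_upwards [(isOpen_interior.inter hU).mem_nhds ⟨hx, hxU⟩] with y hy
      rw [h0]
      exact hle y hy
    exact hmax.fderiv_eq_zero
  -- The shift by `1` makes `θ n` vanish already where `g ≥ -1/(n+1)`, which keeps its support off
  -- the boundary. It equals `1` where `g ≤ -2/(n+1)`.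
  set θ : ℕ → Plane → ℝ := fun n x => Real.smoothTransition (-((n : ℝ) + 1) * g x - 1) with hθ
  have hθat : ∀ n, ∀ x ∈ U, ContDiffAt ℝ 1 (θ n) x := fun n x hx =>
    Real.smoothTransition.contDiffAt.comp x
      ((contDiffAt_const.mul (hgat x hx)).sub contDiffAt_const)
  have hψz : ∀ x, x ∉ tsupport ψ → ψ =ᶠ[𝓝 x] 0 := fun x hx =>
    notMem_tsupport_iff_eventuallyEq.1 hx
  have hψn : ∀ n, ContDiff ℝ 1 fun x => ψ x * θ n x := by
    intro n
    refine contDiff_iff_contDiffAt.2 fun x => ?_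
    by_cases hx : x ∈ tsupport ψ
    · exact hψ.contDiffAt.mul (hθat n x (hψU hx))
    · refine (contDiffAt_const (c := (0 : ℝ))).congr_of_eventuallyEq ?_
      filter_upwards [hψz x hx] with y hy
      simp [hy]
  have hsupp : ∀ n, tsupport (fun x => ψ x * θ n x) ⊆ interior C := by
    intro n x hx
    have hxU : x ∈ U := hψU (tsupport_mul_subset_left hx)
    have hgc : ContinuousAt g x := (hgat x hxU).continuousAt
    have hgx : g x < 0 := by
      by_contra hge
      push Not at hge
      refine (notMem_tsupport_iff_eventuallyEq.2 ?_) hx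
      have hc : ContinuousAt (fun y => -((n : ℝ) + 1) * g y - 1) x := by fun_prop
      have hlt : -((n : ℝ) + 1) * g x - 1 < 0 := by
        nlinarith [n.cast_nonneg (α := ℝ), mul_nonneg (n.cast_nonneg (α := ℝ)) hge]
      filter_upwards [hc.eventually (gt_mem_nhds hlt)] with y hy
      simp only [hθ, Real.smoothTransition.zero_of_nonpos hy.le, mul_zero, Pi.zero_apply]
    refine mem_interior_iff_mem_nhds.2 ?_
    filter_upwards [hgc.eventually (gt_mem_nhds hgx), hU.mem_nhds hxU] with y hy hyU
    have : y ∈ C ∩ U := by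
      rw [hCU]
      exact ⟨hyU, hy.le⟩
    exact this.1
  have hzero : ∀ n, boundaryFlux C q q' X (fun x => ψ x * θ n x) = 0 := fun n =>
    h.boundaryFlux_eq_zero hC hq hq' hX isOpen_interior
      (disjoint_interior_frontier.mono_right sdiff_subset) (hψn n) hψc.mul_right (hsupp n)
  set F : Plane → ℝ := fun x => fderiv ℝ ψ x (X x) * q x
    + ψ x * (X x 0 * q' 0 x + X x 1 * q' 1 x) with hF
  have hFint : IntegrableOn F (interior C) :=
    integrable_boundaryFlux hC hq hq' hX.contDiff.continuous hψ
  have hFz : ∀ x, x ∉ tsupport ψ → F x = 0 := fun x hx => by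
    simp [hF, image_eq_zero_of_notMem_tsupport hx, (hψz x hx).fderiv_eq]
  -- Off `U` nothing is known about `g`, so `θ n` is restricted to the support of `ψ`, outside of
  -- which `F` vanishes anyway.
  set T : ℕ → Plane → ℝ := fun n => (tsupport ψ).indicator (θ n) with hT
  have hTm : ∀ n, AEStronglyMeasurable (T n) (volume.restrict (interior C)) := by
    intro n
    have hcont : ContinuousOn (θ n) (tsupport ψ) := fun x hx =>
      (hθat n x (hψU hx)).continuousAt.continuousWithinAt
    have : AEStronglyMeasurable (T n) volume :=
      (aestronglyMeasurable_indicator_iff (isClosed_tsupport ψ).measurableSet).2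
        (hcont.aestronglyMeasurable (isClosed_tsupport ψ).measurableSet)
    exact this.restrict
  have hTb : ∀ n x, ‖T n x‖ ≤ 1 := fun n x => by
    by_cases hx : x ∈ tsupport ψ
    · simp only [hT, indicator_of_mem hx, hθ, Real.norm_eq_abs,
        abs_of_nonneg (Real.smoothTransition.nonneg _)]
      exact Real.smoothTransition.le_one _
    · simp [hT, hx]
  have hTF : ∀ n, IntegrableOn (fun x => T n x * F x) (interior C) := fun n =>
    hFint.bdd_mul (c := 1) (hTm n) (Eventually.of_forall (hTb n))
  have hpos : ∀ n, 0 ≤ ∫ x in interior C, T n x * F x := by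
    intro n
    rw [← hzero n]
    refine integral_mono (integrable_boundaryFlux hC hq hq' hX.contDiff.continuous (hψn n))
      (hTF n) fun x => ?_
    by_cases hx : x ∈ tsupport ψ
    · have hxU := hψU hx
      have hder : HasFDerivAt (θ n) (deriv Real.smoothTransition (-((n : ℝ) + 1) * g x - 1) •
          ((-((n : ℝ) + 1)) • fderiv ℝ g x)) x := by
        have h1 : HasDerivAt Real.smoothTransition _ (-((n : ℝ) + 1) * g x - 1) :=
          (Real.smoothTransition.contDiffAt (n := 1) |>.differentiableAt one_ne_zero).hasDerivAt
        exact h1.comp_hasFDerivAt x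
          ((((hgat x hxU).differentiableAt one_ne_zero).hasFDerivAt.const_mul _).sub_const 1)
      have hfd := ((hψ.differentiable one_ne_zero x).hasFDerivAt.mul hder).fderiv
      have hfd' : fderiv ℝ (fun x => ψ x * θ n x) x = _ := hfd
      have e1 : 0 ≤ ψ x * (deriv Real.smoothTransition (-((n : ℝ) + 1) * g x - 1) *
          (((n : ℝ) + 1) * fderiv ℝ g x (X x))) * q x :=
        mul_nonneg (mul_nonneg (hψ0 x) (mul_nonneg (deriv_smoothTransition_nonneg _)
          (mul_nonneg (by positivity) (hgX x hxU)))) (hq0 x)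
      simp only [hT, indicator_of_mem hx, hfd', hF, _root_.add_apply, _root_.smul_apply,
        smul_eq_mul]
      nlinarith [e1]
    · have hz : (fun y => ψ y * θ n y) =ᶠ[𝓝 x] 0 := by
        filter_upwards [hψz x hx] with y hy
        simp [hy]
      simp [hF, image_eq_zero_of_notMem_tsupport hx, hz.fderiv_eq, hx, hT]
  have hlim : Tendsto (fun n => ∫ x in interior C, T n x * F x) atTop
      (𝓝 (∫ x in interior C, F x)) := by
    refine tendsto_integral_of_dominated_convergence (fun x => ‖F x‖)
      (fun n => (hTF n).aestronglyMeasurable) hFint.norm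
      (fun n => Eventually.of_forall fun x => ?_) ?_
    · rw [norm_mul]
      exact mul_le_of_le_one_left (norm_nonneg _) (hTb n x)
    · filter_upwards [ae_restrict_mem isOpen_interior.measurableSet] with x hx
      by_cases hxs : x ∈ tsupport ψ
      · have hgx := hneg x hx (hψU hxs)
        obtain ⟨N, hN⟩ := exists_nat_ge (2 / -g x)
        refine tendsto_const_nhds.congr' ?_
        filter_upwards [eventually_ge_atTop N] with n hn
        have h2 : 2 ≤ (n : ℝ) * -g x := by
          rw [div_le_iff₀ (by linarith)] at hN
          have : (N : ℝ) ≤ n := by exact_mod_cast hn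
          nlinarith
        have : (1 : ℝ) ≤ -((n : ℝ) + 1) * g x - 1 := by nlinarith
        simp only [hT, indicator_of_mem hxs, hθ, Real.smoothTransition.one_of_one_le this, one_mul]
      · simp [hFz x hxs]
  exact ge_of_tendsto' hlim hpos

/-- Near a point where `V` is tangent to the boundary, `V · n` may change sign arbitrarily often.
Adding `κ w` with `w` transverse and outward makes each point either strict inflow for `V`, where
the flux vanishes for every transport field, or strict outflow for `V + κ w`. The flux is affine in
`κ`, so `κ → 0` is harmless. -/
lemma boundaryFlux_nonneg_of_regular {Γ : Set Plane} (hC : IsCompact C)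
    (h : HasNoFluxOn C Γ q q') (hq : IntegrableOn q (interior C))
    (hq' : ∀ i, IntegrableOn (q' i) (interior C)) (hq0 : ∀ x, 0 ≤ q x)
    {V : Plane → Plane} (hV : IsTransportField V)
    {U : Set Plane} (hU : IsOpen U) {g : Plane → ℝ} (hg : ContDiffOn ℝ 1 g U)
    (hCU : C ∩ U = {y ∈ U | g y ≤ 0}) {w : Plane} (hw : ∀ y ∈ U, 0 < fderiv ℝ g y w)
    (hΓ : ∀ y ∈ frontier C ∩ U, fderiv ℝ g y (V y) < 0 → y ∈ Γ)
    {ψ : Plane → ℝ} (hψ : ContDiff ℝ 1 ψ) (hψc : HasCompactSupport ψ) (hψ0 : ∀ x, 0 ≤ ψ x)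
    (hψU : tsupport ψ ⊆ U) : 0 ≤ boundaryFlux C q q' V ψ := by
  have hVc := hV.contDiff.continuous
  have hdg : ContinuousOn (fderiv ℝ g) U := hg.continuousOn_fderiv_of_isOpen hU le_rfl
  have key : ∀ κ : ℝ, 0 < κ → 0 ≤ boundaryFlux C q q' (fun x => V x + κ • w) ψ := by
    intro κ hκ
    refine boundaryFlux_nonneg_of_local hC hq hq' (hVc.add continuous_const) hψ hψc hψ0
      fun x hx => ?_
    have hcV : ContinuousOn (fun y => fderiv ℝ g y (V y)) U := hdg.clm_apply hVc.continuousOn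
    have hcW : ContinuousOn (fun y => fderiv ℝ g y (V y + κ • w)) U :=
      hdg.clm_apply (hVc.add continuous_const).continuousOn
    have hxU := hψU hx
    rcases lt_or_ge (fderiv ℝ g x (V x)) 0 with hlt | hge
    -- Inflow for the unperturbed `V`: this part of the boundary lies in `Γ`, where nothing flows
    -- through.
    · refine ⟨U ∩ (fun y => fderiv ℝ g y (V y)) ⁻¹' Iio 0, hcV.isOpen_inter_preimage hU isOpen_Iio,
        ⟨hxU, hlt⟩, fun χ hχ hχc _ hχU => le_of_eq (Eq.symm ?_)⟩
      refine h.boundaryFlux_eq_zero hC hq hq' (hV.add_const _)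
        (hcV.isOpen_inter_preimage hU isOpen_Iio) ?_ hχ hχc hχU
      refine disjoint_left.2 fun y hy hy' => hy'.2 (hΓ y ⟨hy'.1, hy.1⟩ hy.2)
    · refine ⟨U ∩ (fun y => fderiv ℝ g y (V y + κ • w)) ⁻¹' Ioi 0,
        hcW.isOpen_inter_preimage hU isOpen_Ioi, ⟨hxU, ?_⟩, fun χ hχ hχc hχ0 hχU => ?_⟩
      · simp only [mem_preimage, map_add, map_smul, smul_eq_mul, mem_Ioi]
        have := mul_pos hκ (hw x hxU)
        linarith
      · refine boundaryFlux_nonneg_of_outflow hC h hq hq' hq0 (hV.add_const _)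
          (hcW.isOpen_inter_preimage hU isOpen_Ioi) (hg.mono inter_subset_left) ?_
          (fun y hy h0 => ?_) (fun y hy => hy.2.le) hχ hχc hχ0 hχU
        · rw [← inter_assoc, hCU]
          ext y
          simp only [mem_inter_iff, mem_ofPred_eq]
          tauto
        · have := hw y hy.1
          simp [h0] at this
  have hlim : Tendsto (fun κ : ℝ => boundaryFlux C q q' V ψ
      + κ * boundaryFlux C q q' (fun _ => w) ψ) (𝓝[>] 0) (𝓝 (boundaryFlux C q q' V ψ)) := by
    have : Continuous fun κ : ℝ => boundaryFlux C q q' V ψ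
      + κ * boundaryFlux C q q' (fun _ => w) ψ := by fun_prop
    have h1 := (this.tendsto 0).mono_left (nhdsWithin_le_nhds (s := Ioi 0))
    simpa using h1
  refine ge_of_tendsto hlim ?_
  filter_upwards [self_mem_nhdsWithin] with κ hκ
  rw [← boundaryFlux_add_const hC hq hq' hVc w κ hψ]
  exact key κ hκ

lemma fderiv_eq_inner_gradient {g : Plane → ℝ} (x v : Plane) :
    fderiv ℝ g x v = inner ℝ (∇ g x) v := by
  simp [gradient]

/-- A single defining function `g` certifies the normal at all nearby boundary points too. There `g
= 0`, since `g < 0` would put the point into the interior. This is what places nearby inflow points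
in `leadingEdge`. -/
lemma isOutwardNormal_of_fderiv_ne_zero (hC : IsClosed C) {U : Set Plane} (hU : IsOpen U)
    {g : Plane → ℝ} (hg : ContDiffOn ℝ 1 g U) (hCU : C ∩ U = {y ∈ U | g y ≤ 0}) {y : Plane}
    (hy : y ∈ frontier C) (hyU : y ∈ U) (hg' : fderiv ℝ g y ≠ 0) :
    IsOutwardNormal C y (‖∇ g y‖⁻¹ • ∇ g y) := by
  have hne : ∇ g y ≠ 0 := fun h0 => hg' (by ext v; simp [fderiv_eq_inner_gradient, h0])
  have hn : ‖∇ g y‖ ≠ 0 := norm_ne_zero_iff.2 hne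
  refine ⟨by rw [norm_smul, norm_inv, norm_norm, inv_mul_cancel₀ hn], U, g, ‖∇ g y‖, hU, hyU, hg,
    ?_, norm_pos_iff.2 hne, by rw [smul_smul, mul_inv_cancel₀ hn, one_smul], hCU⟩
  have hyC : y ∈ C ∩ U := ⟨hC.frontier_subset hy, hyU⟩
  rw [hCU] at hyC
  refine le_antisymm hyC.2 (not_lt.1 fun hlt => hy.2 (mem_interior_iff_mem_nhds.2 ?_))
  have hgc : ContinuousAt g y := (hg.contDiffAt (hU.mem_nhds hyU)).continuousAt
  filter_upwards [hgc.eventually (gt_mem_nhds hlt), hU.mem_nhds hyU] with x hx hxU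
  have : x ∈ C ∩ U := by
    rw [hCU]
    exact ⟨hxU, hx.le⟩
  exact this.1

/-- Localisation reduces to two cases: off the boundary the flux vanishes, and at a regular boundary
point the normal `n` there serves as the transverse direction, on the neighbourhood where `g` still
increases along `n`. -/
lemma boundaryFlux_nonneg_away_from_corners (hC : IsCompact C) {V : Plane → Plane}
    (h : HasNoFluxOn C (leadingEdge C V) q q') (hq : IntegrableOn q (interior C))
    (hq' : ∀ i, IntegrableOn (q' i) (interior C)) (hq0 : ∀ x, 0 ≤ q x)
    (hV : IsTransportField V) {F : Set Plane}
    (hF : ∀ x ∈ frontier C \ F, ∃ n : Plane, IsOutwardNormal C x n)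
    {ψ : Plane → ℝ} (hψ : ContDiff ℝ 1 ψ) (hψc : HasCompactSupport ψ) (hψ0 : ∀ x, 0 ≤ ψ x)
    (hψF : Disjoint (tsupport ψ) F) : 0 ≤ boundaryFlux C q q' V ψ := by
  refine boundaryFlux_nonneg_of_local hC hq hq' hV.contDiff.continuous hψ hψc hψ0 fun x hx => ?_
  by_cases hxf : x ∈ frontier C
  · obtain ⟨n, hn, U, g, a, hU, hxU, hg, -, ha, hgrad, hCU⟩ :=
      hF x ⟨hxf, fun hxF => disjoint_left.1 hψF hx hxF⟩
    have hdg : ContinuousOn (fderiv ℝ g) U := hg.continuousOn_fderiv_of_isOpen hU le_rfl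
    have hopen : IsOpen (U ∩ (fun y => fderiv ℝ g y n) ⁻¹' Ioi 0) :=
      (hdg.clm_apply continuousOn_const).isOpen_inter_preimage hU isOpen_Ioi
    refine ⟨_, hopen, ⟨hxU, ?_⟩, fun χ hχ hχc hχ0 hχU =>
      boundaryFlux_nonneg_of_regular hC h hq hq' hq0 hV hopen (hg.mono inter_subset_left) ?_
        (w := n) (fun y hy => hy.2) (fun y hy hlt => ?_) hχ hχc hχ0 hχU⟩
    · simp only [mem_preimage, mem_Ioi, fderiv_eq_inner_gradient, hgrad, inner_smul_left,
        real_inner_self_eq_norm_sq, hn]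
      simpa using ha
    · rw [← inter_assoc, hCU]
      ext y
      simp only [mem_inter_iff, mem_ofPred_eq]
      tauto
    · have hne : fderiv ℝ g y ≠ 0 := fun h0 => by simp [h0] at hlt
      refine ⟨hy.1, _, isOutwardNormal_of_fderiv_ne_zero hC.isClosed hU hg hCU hy.1 hy.2.1 hne, ?_⟩
      rw [real_inner_comm, inner_smul_left, ← fderiv_eq_inner_gradient]
      refine mul_neg_of_pos_of_neg ?_ hlt
      refine inv_pos.2 (norm_pos_iff.2 fun h0 => hne ?_)
      ext v
      simp [fderiv_eq_inner_gradient, h0]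
  · refine ⟨(frontier C)ᶜ, isClosed_frontier.isOpen_compl, hxf, fun χ hχ hχc _ hχU =>
      (h.boundaryFlux_eq_zero hC hq hq' hV isClosed_frontier.isOpen_compl
        (disjoint_compl_left.mono_right sdiff_subset) hχ hχc hχU).ge⟩

/-- If `q ≥ 0` has no flux through the inflow boundary, its total flux is nonnegative. The finitely
many corners are removed by cut-off functions of a first integral `P` of the transport field. -/
lemma boundaryFlux_nonneg (hC : IsCompact C) {V : Plane → Plane}
    (h : HasNoFluxOn C (leadingEdge C V) q q') (hq : IntegrableOn q (interior C))
    (hq' : ∀ i, IntegrableOn (q' i) (interior C)) (hq0 : ∀ x, 0 ≤ q x)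
    (hV : IsTransportField V) {F : Set Plane}
    (hF : ∀ x ∈ frontier C \ F, ∃ n : Plane, IsOutwardNormal C x n)
    {P : Plane → ℝ} (hP : ContDiff ℝ 1 P) (hP0 : ∀ x, 0 ≤ P x)
    (hPV : ∀ x, fderiv ℝ P x (V x) = 0) (hPF : ∀ x ∈ F, P x = 0)
    (hPnull : volume {x | P x = 0} = 0)
    {ψ : Plane → ℝ} (hψ : ContDiff ℝ 1 ψ) (hψc : HasCompactSupport ψ) (hψ0 : ∀ x, 0 ≤ ψ x) :
    0 ≤ boundaryFlux C q q' V ψ := by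
  -- `θ n` vanishes near the zero set of `P`, which contains the corners. As `P` is constant along
  -- `V`, so is `θ n`, and the cut-off costs no derivative term, however large its gradient.
  set θ : ℕ → Plane → ℝ := fun n x => Real.smoothTransition ((n : ℝ) * P x - 1) with hθ
  have hθc : ∀ n, ContDiff ℝ 1 (θ n) := fun n =>
    Real.smoothTransition.contDiff.comp ((contDiff_const.mul hP).sub contDiff_const)
  set G : Plane → ℝ := fun x => fderiv ℝ ψ x (V x) * q x
    + ψ x * (V x 0 * q' 0 x + V x 1 * q' 1 x) with hG
  have hGint : IntegrableOn G (interior C) :=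
    integrable_boundaryFlux hC hq hq' hV.contDiff.continuous hψ
  have hθb : ∀ n x, ‖θ n x‖ ≤ 1 := fun n x => by
    simp only [hθ, Real.norm_eq_abs, abs_of_nonneg (Real.smoothTransition.nonneg _)]
    exact Real.smoothTransition.le_one _
  have hpos : ∀ n, 0 ≤ ∫ x in interior C, θ n x * G x := by
    intro n
    have hdisj : Disjoint (tsupport fun x => ψ x * θ n x) F := by
      refine disjoint_left.2 fun x hx hxF => (notMem_tsupport_iff_eventuallyEq.2 ?_) hx
      have hc : ContinuousAt (fun y => (n : ℝ) * P y - 1) x := by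
        have := hP.continuous.continuousAt (x := x)
        fun_prop
      have hlt : (n : ℝ) * P x - 1 < 0 := by rw [hPF x hxF]; norm_num
      filter_upwards [hc.eventually (gt_mem_nhds hlt)] with y hy
      simp only [hθ, Real.smoothTransition.zero_of_nonpos hy.le, mul_zero, Pi.zero_apply]
    have := boundaryFlux_nonneg_away_from_corners hC h hq hq' hq0 hV hF (hψ.mul (hθc n))
      hψc.mul_right (fun x => mul_nonneg (hψ0 x) (Real.smoothTransition.nonneg _)) hdisj
    refine this.trans_eq (integral_congr_ae (Eventually.of_forall fun x => ?_))
    have hder : fderiv ℝ (θ n) x (V x) = 0 := by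
      have h1 : HasDerivAt Real.smoothTransition _ ((n : ℝ) * P x - 1) :=
        (Real.smoothTransition.contDiffAt (n := 1) |>.differentiableAt one_ne_zero).hasDerivAt
      have h2 := h1.comp_hasFDerivAt x
        (((hP.differentiable one_ne_zero x).hasFDerivAt.const_mul (n : ℝ)).sub_const 1)
      have h3 : fderiv ℝ (θ n) x = _ := h2.fderiv
      rw [h3]
      simp [hPV]
    simp only [hG, fderiv_fun_mul (hψ.differentiable one_ne_zero x)
      ((hθc n).differentiable one_ne_zero x), _root_.add_apply, _root_.smul_apply, hder,
      smul_eq_mul]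
    ring
  have hlim : Tendsto (fun n => ∫ x in interior C, θ n x * G x) atTop
      (𝓝 (∫ x in interior C, G x)) := by
    refine tendsto_integral_of_dominated_convergence (fun x => ‖G x‖)
      (fun n => (hθc n).continuous.aestronglyMeasurable.mul hGint.aestronglyMeasurable)
      hGint.norm (fun n => Eventually.of_forall fun x => ?_) ?_
    · rw [norm_mul]
      exact mul_le_of_le_one_left (norm_nonneg _) (hθb n x)
    · have : ∀ᵐ x : Plane, P x ≠ 0 := by
        rw [ae_iff]
        simpa using hPnull
      filter_upwards [ae_restrict_of_ae this] with x hx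
      have hPx : 0 < P x := lt_of_le_of_ne (hP0 x) (Ne.symm hx)
      obtain ⟨N, hN⟩ := exists_nat_ge (2 / P x)
      refine tendsto_const_nhds.congr' ?_
      filter_upwards [eventually_ge_atTop N] with n hn
      have : (1 : ℝ) ≤ (n : ℝ) * P x - 1 := by
        rw [div_le_iff₀ hPx] at hN
        have : (N : ℝ) ≤ n := by exact_mod_cast hn
        nlinarith
      simp only [hθ, Real.smoothTransition.one_of_one_le this, one_mul]
  exact ge_of_tendsto' hlim hpos

end Flux

/-! ### Weighted energies -/

section Energy

open Matrix

lemma matForm_add_left (S : Matrix (Fin 2) (Fin 2) ℝ) (a b c : Plane) :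
    matForm S (a + b) c = matForm S a c + matForm S b c := inner_add_left _ _ _

lemma matForm_add_right (S : Matrix (Fin 2) (Fin 2) ℝ) (a b c : Plane) :
    matForm S a (b + c) = matForm S a b + matForm S a c := by
  simp [matForm, inner_add_right]

lemma matForm_smul_left (S : Matrix (Fin 2) (Fin 2) ℝ) (r : ℝ) (a b : Plane) :
    matForm S (r • a) b = r * matForm S a b := by
  simp [matForm, inner_smul_left]

lemma matForm_smul_right (S : Matrix (Fin 2) (Fin 2) ℝ) (r : ℝ) (a b : Plane) :
    matForm S a (r • b) = r * matForm S a b := by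
  simp [matForm, inner_smul_right]

lemma matForm_comm {S : Matrix (Fin 2) (Fin 2) ℝ} (hS : S.IsHermitian) (a b : Plane) :
    matForm S a b = matForm S b a := by
  have h : S 1 0 = S 0 1 := by simpa using hS.apply 0 1
  simp only [matForm_eq_sum, Fintype.sum_prod_type, Fin.sum_univ_two, h]
  ring

lemma matForm_eq_dotProduct (S : Matrix (Fin 2) (Fin 2) ℝ) (a b : Plane) :
    matForm S a b = a.ofLp ⬝ᵥ (S *ᵥ b.ofLp) := by
  simp only [matForm_eq_sum, Fintype.sum_prod_type, Fin.sum_univ_two, dotProduct, mulVec]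
  ring

lemma matForm_self_pos {S : Matrix (Fin 2) (Fin 2) ℝ} (hS : S.PosDef) {v : Plane} (hv : v ≠ 0) :
    0 < matForm S v v := by
  have h := hS.dotProduct_mulVec_pos (x := v.ofLp)
    (fun h0 => hv (by ext i; simpa using congrFun h0 i))
  rw [matForm_eq_dotProduct]
  simpa using h

lemma matForm_self_nonneg {S : Matrix (Fin 2) (Fin 2) ℝ} (hS : S.PosSemidef) (v : Plane) :
    0 ≤ matForm S v v := by
  rw [matForm_eq_dotProduct]
  simpa using hS.dotProduct_mulVec_nonneg v.ofLp

lemma continuous_matForm_self (S : Matrix (Fin 2) (Fin 2) ℝ) :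
    Continuous fun v => matForm S v v :=
  continuous_id.inner (LinearMap.continuous_of_finiteDimensional _)

lemma exists_matForm_lower_bound {S : Matrix (Fin 2) (Fin 2) ℝ} (hS : S.PosDef) :
    ∃ σ : ℝ, 0 < σ ∧ ∀ v, σ * ‖v‖ ^ 2 ≤ matForm S v v := by
  have hne : (Metric.sphere (0 : Plane) 1).Nonempty :=
    ⟨EuclideanSpace.single 0 1, by simp⟩
  obtain ⟨w, hw, hmin⟩ := (isCompact_sphere (0 : Plane) 1).exists_isMinOn hne
    (continuous_matForm_self S).continuousOn
  have hw0 : w ≠ 0 := fun h0 => by simp [h0] at hw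
  refine ⟨_, matForm_self_pos hS hw0, fun v => ?_⟩
  rcases eq_or_ne v 0 with rfl | hv
  · simp [matForm]
  · have hn : ‖v‖ ≠ 0 := norm_ne_zero_iff.2 hv
    have h1 : matForm S w w ≤ matForm S (‖v‖⁻¹ • v) (‖v‖⁻¹ • v) :=
      hmin (by simp [norm_smul, hn])
    rw [matForm_smul_left, matForm_smul_right] at h1
    calc matForm S w w * ‖v‖ ^ 2
        ≤ ‖v‖⁻¹ * (‖v‖⁻¹ * matForm S v v) * ‖v‖ ^ 2 := by gcongr
      _ = matForm S v v := by field_simp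

/-- The operator norm of a matrix with respect to the Euclidean norm. -/
def matNorm (S : Matrix (Fin 2) (Fin 2) ℝ) : ℝ :=
  ‖LinearMap.toContinuousLinearMap (Matrix.toEuclideanLin S)‖

lemma matNorm_nonneg (S : Matrix (Fin 2) (Fin 2) ℝ) : 0 ≤ matNorm S := norm_nonneg _

lemma norm_toEuclideanLin_le (S : Matrix (Fin 2) (Fin 2) ℝ) (v : Plane) :
    ‖Matrix.toEuclideanLin S v‖ ≤ matNorm S * ‖v‖ :=
  (LinearMap.toContinuousLinearMap (Matrix.toEuclideanLin S)).le_opNorm v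

lemma abs_matForm_le (S : Matrix (Fin 2) (Fin 2) ℝ) (a b : Plane) :
    |matForm S a b| ≤ matNorm S * (‖a‖ * ‖b‖) := by
  calc |matForm S a b| ≤ ‖a‖ * ‖Matrix.toEuclideanLin S b‖ := abs_real_inner_le_norm _ _
    _ ≤ ‖a‖ * (matNorm S * ‖b‖) := by gcongr; exact norm_toEuclideanLin_le S b
    _ = _ := by ring

/-- The exponential weight `exp (c ⟨a, x⟩)`. -/
def expWeight (a : Plane) (c : ℝ) (x : Plane) : ℝ := Real.exp (c * inner ℝ a x)

lemma contDiff_expWeight (a : Plane) (c : ℝ) : ContDiff ℝ 1 (expWeight a c) :=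
  Real.contDiff_exp.comp (contDiff_const.mul (contDiff_const.inner ℝ contDiff_id))

lemma fderiv_expWeight (a : Plane) (c : ℝ) (x v : Plane) :
    fderiv ℝ (expWeight a c) x v = c * inner ℝ a v * expWeight a c x := by
  have h := (((innerSL ℝ a).hasFDerivAt (x := x)).const_mul c).exp
  have h' : fderiv ℝ (expWeight a c) x = _ := h.fderiv
  rw [h']
  simp only [expWeight, _root_.smul_apply, innerSL_apply_apply, smul_eq_mul]
  ring

variable {C : Set Plane}

/-- The energy `∫ p ⟨u, S w⟩` with the weight `p = exp (c ⟨a, ·⟩)`. -/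
def weightedForm (C : Set Plane) (a : Plane) (c : ℝ) (S : Matrix (Fin 2) (Fin 2) ℝ)
    (u w : L2 C) : ℝ :=
  ∫ x in interior C, expWeight a c x * matForm S (u x) (w x)

lemma integrable_weightedForm (hC : IsCompact C) (a : Plane) (c : ℝ)
    (S : Matrix (Fin 2) (Fin 2) ℝ) (u w : L2 C) :
    IntegrableOn (fun x => expWeight a c x * matForm S (u x) (w x)) (interior C) :=
  integrable_continuous_mul hC (contDiff_expWeight a c).continuous (integrableOn_matForm S u w)

lemma integral_norm_mul_norm_le (u w : L2 C) :
    ∫ x in interior C, ‖u x‖ * ‖w x‖ ≤ ‖u‖ * ‖w‖ := by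
  have hu := (Lp.memLp u).norm
  have hw := (Lp.memLp w).norm
  have h := real_inner_le_norm (hu.toLp _) (hw.toLp _)
  rw [Lp.norm_toLp, Lp.norm_toLp, eLpNorm_norm, eLpNorm_norm, ← Lp.norm_def, ← Lp.norm_def,
    L2.inner_def] at h
  refine le_of_eq_of_le (integral_congr_ae ?_) h
  filter_upwards [hu.coeFn_toLp, hw.coeFn_toLp] with x h1 h2
  simp [h1, h2, mul_comm]

lemma integral_norm_sq_eq (u : L2 C) : ∫ x in interior C, ‖u x‖ ^ 2 = ‖u‖ ^ 2 := by
  rw [← real_inner_self_eq_norm_sq, L2.inner_def]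
  simp_rw [real_inner_self_eq_norm_sq]

/-- Boundedness on `L²` allows the energy to be differentiated along a `C¹` curve in `L²`. -/
lemma isBoundedBilinearMap_weightedForm (hC : IsCompact C) (a : Plane) (c : ℝ)
    (S : Matrix (Fin 2) (Fin 2) ℝ) :
    IsBoundedBilinearMap ℝ fun p : L2 C × L2 C => weightedForm C a c S p.1 p.2 := by
  obtain ⟨W, hW⟩ := hC.exists_bound_of_continuousOn (contDiff_expWeight a c).continuous.continuousOn
  refine ⟨fun u v w => ?_, fun r u w => ?_, fun u v w => ?_, fun r u w => ?_,
    -- The maximum with `1` and the `+ 1` only make the constant strictly positive.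
    max W 1 * (matNorm S + 1), by have := matNorm_nonneg S; positivity, fun u w => ?_⟩
  · simp only [weightedForm]
    rw [← integral_add (integrable_weightedForm hC a c S u w)
      (integrable_weightedForm hC a c S v w)]
    refine integral_congr_ae ?_
    filter_upwards [Lp.coeFn_add u v] with x hx
    rw [hx, Pi.add_apply, matForm_add_left, mul_add]
  · simp only [weightedForm]
    rw [smul_eq_mul, ← integral_const_mul]
    refine integral_congr_ae ?_
    filter_upwards [Lp.coeFn_smul r u] with x hx
    rw [hx, Pi.smul_apply, matForm_smul_left]
    ring
  · simp only [weightedForm]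
    rw [← integral_add (integrable_weightedForm hC a c S u v)
      (integrable_weightedForm hC a c S u w)]
    refine integral_congr_ae ?_
    filter_upwards [Lp.coeFn_add v w] with x hx
    rw [hx, Pi.add_apply, matForm_add_right, mul_add]
  · simp only [weightedForm]
    rw [smul_eq_mul, ← integral_const_mul]
    refine integral_congr_ae ?_
    filter_upwards [Lp.coeFn_smul r w] with x hx
    rw [hx, Pi.smul_apply, matForm_smul_right]
    ring
  · have hint : IntegrableOn (fun x => ‖u x‖ * ‖w x‖) (interior C) :=
      (Lp.memLp u).norm.integrable_fun_mul (Lp.memLp w).norm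
    calc ‖weightedForm C a c S u w‖
        ≤ ∫ x in interior C, (max W 1 * (matNorm S + 1)) * (‖u x‖ * ‖w x‖) := by
          refine norm_integral_le_of_norm_le (hint.const_mul _) ?_
          filter_upwards [ae_restrict_mem isOpen_interior.measurableSet] with x hx
          rw [norm_mul, mul_assoc]
          have h1 := (hW x (interior_subset hx)).trans (le_max_left W 1)
          have h2 : ‖matForm S (u x) (w x)‖ ≤ (matNorm S + 1) * (‖u x‖ * ‖w x‖) :=
            (abs_matForm_le S _ _).trans (by gcongr; linarith)
          exact mul_le_mul h1 h2 (norm_nonneg _) (by positivity)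
      _ ≤ (max W 1 * (matNorm S + 1)) * (‖u‖ * ‖w‖) := by
          rw [integral_const_mul]
          have := matNorm_nonneg S
          gcongr
          exact integral_norm_mul_norm_le u w
      _ = _ := by ring

/-- Every finite set lies in a null level set of a nonnegative first integral of `V`. -/
def HasFirstIntegrals (V : Plane → Plane) : Prop :=
  ∀ F : Set Plane, F.Finite → ∃ P : Plane → ℝ, ContDiff ℝ 1 P ∧ (∀ x, 0 ≤ P x) ∧
    (∀ x, fderiv ℝ P x (V x) = 0) ∧ (∀ x ∈ F, P x = 0) ∧ volume {x | P x = 0} = 0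

/-- The flux of `p ⟨u, S u⟩ V` is nonnegative, and `∂_V p = c ⟨a, V⟩ p ≤ -c p` turns the derivative
of the weight into a gain of `c` times the energy. -/
lemma weighted_transport_le (hC : IsCompact C) (hbd : HasPiecewiseC1Boundary C)
    {V : Plane → Plane} (hV : IsTransportField V) (hVP : HasFirstIntegrals V)
    {a : Plane} (ha : ∀ x ∈ C, inner ℝ a (V x) ≤ -1) {c : ℝ} (hc : 0 ≤ c)
    {S : Matrix (Fin 2) (Fin 2) ℝ} (hS : S.PosSemidef) {u : L2 C} {D : Fin 2 → L2 C}
    (h : HasZeroTraceOn C (leadingEdge C V) u D) :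
    c * weightedForm C a c S u u ≤ ∫ x in interior C, expWeight a c x *
      (V x 0 * (matForm S (D 0 x) (u x) + matForm S (u x) (D 0 x))
        + V x 1 * (matForm S (D 1 x) (u x) + matForm S (u x) (D 1 x))) := by
  obtain ⟨F, hFfin, hF⟩ := hbd
  obtain ⟨P, hP, hP0, hPV, hPF, hPn⟩ := hVP F hFfin
  obtain ⟨R, hR, hCR⟩ := hC.isBounded.subset_ball_lt 0 0
  -- `χ = 1` near `C`: it makes the weight compactly supported without changing any integral over
  -- `C`.
  let χ : ContDiffBump (0 : Plane) := ⟨R, R + 1, hR, by linarith⟩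
  have hq := integrableOn_matForm S u u
  have hq' : ∀ i, IntegrableOn (fun x => matForm S (D i x) (u x) + matForm S (u x) (D i x))
      (interior C) := fun i => (integrableOn_matForm S _ _).fun_add (integrableOn_matForm S _ _)
  have hpc := contDiff_expWeight a c
  have hnn := boundaryFlux_nonneg hC (h.hasNoFluxOn hC S) hq hq'
    (fun x => matForm_self_nonneg hS _) hV hF hP hP0 hPV hPF hPn
    (ψ := fun x => expWeight a c x * χ x) (hpc.mul χ.contDiff) χ.hasCompactSupport.mul_left
    (fun x => mul_nonneg (Real.exp_pos _).le χ.nonneg)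
  have hVi : ∀ i, Continuous fun x => V x i := fun i =>
    (contDiff_coord hV.contDiff i).continuous
  have hI1 := integrable_continuous_mul hC hpc.continuous
    ((integrable_continuous_mul hC (hVi 0) (hq' 0)).fun_add
      (integrable_continuous_mul hC (hVi 1) (hq' 1)))
  have hI2 := integrable_weightedForm hC a c S u u
  rw [← sub_nonneg, weightedForm, ← integral_const_mul, ← integral_sub hI1 (hI2.const_mul c)]
  refine hnn.trans ?_
  rw [boundaryFlux]
  refine integral_mono_ae (integrable_boundaryFlux hC hq hq' hV.contDiff.continuous
    (hpc.mul χ.contDiff)) (hI1.sub (hI2.const_mul c)) ?_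
  filter_upwards [ae_restrict_mem isOpen_interior.measurableSet] with x hx
  have hxC := interior_subset hx
  have hev : (fun x => expWeight a c x * χ x) =ᶠ[𝓝 x] expWeight a c := by
    filter_upwards [χ.eventuallyEq_one_of_mem_ball (hCR hxC)] with y hy
    simp [hy]
  have hx1 : χ x = 1 := (χ.eventuallyEq_one_of_mem_ball (hCR hxC)).eq_of_nhds
  have e1 : c * expWeight a c x * matForm S (u x) (u x) * inner ℝ a (V x)
      ≤ c * expWeight a c x * matForm S (u x) (u x) * (-1) :=
    mul_le_mul_of_nonneg_left (ha x hxC) (mul_nonneg (mul_nonneg hc (Real.exp_pos _).le)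
      (matForm_self_nonneg hS _))
  simp only [hev.fderiv_eq, fderiv_expWeight, hx1, mul_one]
  linarith

end Energy

/-! ### Exponential decay of the weighted energy -/

section Decay

variable {C : Set Plane}

lemma expWeight_bounds {a : Plane} {c W : ℝ} (hc : 0 ≤ c) {x : Plane} (hx : |inner ℝ a x| ≤ W) :
    Real.exp (-(c * W)) ≤ expWeight a c x ∧ expWeight a c x ≤ Real.exp (c * W) := by
  obtain ⟨h1, h2⟩ := abs_le.1 hx
  constructor
  · exact Real.exp_le_exp.2 (by nlinarith)
  · exact Real.exp_le_exp.2 (mul_le_mul_of_nonneg_left h2 hc)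

lemma weightedForm_le (hC : IsCompact C) {a : Plane} {c W : ℝ} (hc : 0 ≤ c)
    (hW : ∀ x ∈ C, |inner ℝ a x| ≤ W) (S : Matrix (Fin 2) (Fin 2) ℝ) (u : L2 C) :
    weightedForm C a c S u u ≤ matNorm S * Real.exp (c * W) * ‖u‖ ^ 2 := by
  rw [← integral_norm_sq_eq, ← integral_const_mul]
  have hint : IntegrableOn (fun x => ‖u x‖ ^ 2) (interior C) := (Lp.memLp u).norm.integrable_sq
  refine integral_mono_ae (integrable_weightedForm hC a c S u u) (hint.const_mul _) ?_
  filter_upwards [ae_restrict_mem isOpen_interior.measurableSet] with x hx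
  have h1 := (expWeight_bounds hc (hW x (interior_subset hx))).2
  have h2 := (le_abs_self _).trans (abs_matForm_le S (u x) (u x))
  have h0 : 0 ≤ expWeight a c x := (Real.exp_pos _).le
  have h3 : 0 ≤ matNorm S * (‖u x‖ * ‖u x‖) := mul_nonneg (matNorm_nonneg S) (by positivity)
  calc expWeight a c x * matForm S (u x) (u x)
      ≤ expWeight a c x * (matNorm S * (‖u x‖ * ‖u x‖)) := mul_le_mul_of_nonneg_left h2 h0
    _ ≤ Real.exp (c * W) * (matNorm S * (‖u x‖ * ‖u x‖)) := mul_le_mul_of_nonneg_right h1 h3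
    _ = _ := by ring

lemma le_weightedForm (hC : IsCompact C) {a : Plane} {c W : ℝ} (hc : 0 ≤ c)
    (hW : ∀ x ∈ C, |inner ℝ a x| ≤ W) {S : Matrix (Fin 2) (Fin 2) ℝ} {σ : ℝ} (hσ : 0 < σ)
    (hS : ∀ v, σ * ‖v‖ ^ 2 ≤ matForm S v v) (u : L2 C) :
    σ * Real.exp (-(c * W)) * ‖u‖ ^ 2 ≤ weightedForm C a c S u u := by
  rw [← integral_norm_sq_eq, ← integral_const_mul]
  have hint : IntegrableOn (fun x => ‖u x‖ ^ 2) (interior C) := (Lp.memLp u).norm.integrable_sq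
  refine integral_mono_ae (hint.const_mul _) (integrable_weightedForm hC a c S u u) ?_
  filter_upwards [ae_restrict_mem isOpen_interior.measurableSet] with x hx
  have h1 := (expWeight_bounds hc (hW x (interior_subset hx))).1
  have h0 : 0 ≤ expWeight a c x := (Real.exp_pos _).le
  calc σ * Real.exp (-(c * W)) * ‖u x‖ ^ 2
      = Real.exp (-(c * W)) * (σ * ‖u x‖ ^ 2) := by ring
    _ ≤ expWeight a c x * (σ * ‖u x‖ ^ 2) := mul_le_mul_of_nonneg_right h1 (by positivity)
    _ ≤ _ := mul_le_mul_of_nonneg_left (hS _) h0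

/-- Grönwall's inequality for `E' ≤ -2 E + k` on `[0, ∞)`. -/
lemma le_exp_neg_two_mul_add {E E' : ℝ → ℝ} {k : ℝ} (hcont : ContinuousOn E (Ici 0))
    (hder : ∀ s, 0 < s → HasDerivAt E (E' s) s) (hle : ∀ s, 0 < s → E' s ≤ -2 * E s + k)
    {s : ℝ} (hk : 0 ≤ k) (hs : 0 ≤ s) : E s ≤ Real.exp (-(2 * s)) * E 0 + k / 2 := by
  have hd : ∀ t, 0 < t → HasDerivAt (fun t => Real.exp (2 * t) * (E t - k / 2))
      (Real.exp (2 * t) * 2 * (E t - k / 2) + Real.exp (2 * t) * E' t) t := fun t ht => by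
    have h1 : HasDerivAt (fun t : ℝ => Real.exp (2 * t)) (Real.exp (2 * t) * 2) t := by
      simpa using ((hasDerivAt_id t).const_mul 2).exp
    exact h1.mul ((hder t ht).sub_const _)
  -- With the integrating factor, `exp (2t) (E - k/2)` has derivative `exp (2t) (2E - k + E') ≤ 0`.
  have hanti : AntitoneOn (fun t => Real.exp (2 * t) * (E t - k / 2)) (Ici 0) := by
    refine antitoneOn_of_deriv_nonpos (convex_Ici 0)
      ((by fun_prop : Continuous fun t : ℝ => Real.exp (2 * t)).continuousOn.mul
        (hcont.sub continuousOn_const)) ?_ ?_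
    · intro t ht
      rw [interior_Ici] at ht
      exact (hd t ht).differentiableAt.differentiableWithinAt
    · intro t ht
      rw [interior_Ici] at ht
      rw [(hd t ht).deriv]
      have : Real.exp (2 * t) * E' t ≤ Real.exp (2 * t) * (-2 * E t + k) :=
        mul_le_mul_of_nonneg_left (hle t ht) (Real.exp_pos _).le
      linarith
  have h := hanti self_mem_Ici (mem_Ici.2 hs) hs
  simp only [mul_zero, Real.exp_zero, one_mul] at h
  have hexp : Real.exp (-(2 * s)) * Real.exp (2 * s) = 1 := by
    rw [← Real.exp_add]; simp
  have h2 := mul_le_mul_of_nonneg_left h (Real.exp_pos (-(2 * s))).le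
  rw [← mul_assoc, hexp, one_mul, mul_sub] at h2
  have h3 : 0 ≤ Real.exp (-(2 * s)) * (k / 2) := by positivity
  linarith

lemma continuous_weightedForm_self (hC : IsCompact C) (a : Plane) (c : ℝ)
    (S : Matrix (Fin 2) (Fin 2) ℝ) : Continuous fun u : L2 C => weightedForm C a c S u u := by
  have h : Continuous fun p : L2 C × L2 C => weightedForm C a c S p.1 p.2 :=
    (isBoundedBilinearMap_weightedForm hC a c S).continuous
  have h' : Continuous fun u : L2 C => (u, u) := continuous_id.prodMk continuous_id
  have h2 := h.comp h'
  simpa only [Function.comp_def] using h2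

lemma hasDerivAt_weightedForm (hC : IsCompact C) (a : Plane) (c : ℝ)
    (S : Matrix (Fin 2) (Fin 2) ℝ) {z : ℝ → L2 C} {z' : L2 C} {t : ℝ} (hz : HasDerivAt z z' t) :
    HasDerivAt (fun t => weightedForm C a c S (z t) (z t))
      (weightedForm C a c S (z t) z' + weightedForm C a c S z' (z t)) t := by
  have hB := isBoundedBilinearMap_weightedForm hC a c S
  have h : HasDerivAt (fun t => (z t, z t)) (z', z') t := hz.prodMk hz
  have := (hB.hasFDerivAt (z t, z t)).comp_hasDerivAt (f := fun t => (z t, z t)) t h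
  rwa [hB.deriv_apply] at this

/-- The energy dissipated by transport dominates the energy produced by the right hand side. -/
lemma weightedForm_deriv_le (hC : IsCompact C) (hbd : HasPiecewiseC1Boundary C)
    {V : Plane → Plane} (hV : IsTransportField V) (hVP : HasFirstIntegrals V)
    {a : Plane} (ha : ∀ x ∈ C, inner ℝ a (V x) ≤ -1) {W : ℝ} (hW : ∀ x ∈ C, |inner ℝ a x| ≤ W)
    {S : Matrix (Fin 2) (Fin 2) ℝ} (hS : S.PosDef) {f : Plane → Plane → Plane} {u u' : L2 C}
    {D : Fin 2 → L2 C} (hD : HasZeroTraceOn C (leadingEdge C V) u D)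
    (heq : ∀ᵐ x ∂((volume : Measure Plane).restrict (interior C)),
      u' x + (V x 0 • D 0 x + V x 1 • D 1 x) = f x (u x))
    {c k : ℝ} (hc : 0 ≤ c) (hk : 0 ≤ k)
    (hf : ∀ x ∈ interior C, ∀ w : Plane, 2 * matForm S w (f x w) ≤ c * matForm S w w + k) :
    weightedForm C a (c + 2) S u u' + weightedForm C a (c + 2) S u' u
      ≤ -2 * weightedForm C a (c + 2) S u u
        + k * (Real.exp ((c + 2) * W) * volume.real (interior C)) := by
  have hfin : volume (interior C) ≠ ⊤ :=
    ((measure_mono interior_subset).trans_lt hC.measure_lt_top).ne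
  have hpint : IntegrableOn (expWeight a (c + 2)) (interior C) :=
    ((contDiff_expWeight a (c + 2)).continuous.continuousOn.integrableOn_compact hC).mono_set
      interior_subset
  have hpvol : ∫ x in interior C, expWeight a (c + 2) x
      ≤ Real.exp ((c + 2) * W) * volume.real (interior C) := by
    have : ∫ x in interior C, expWeight a (c + 2) x
        ≤ ∫ x in interior C, Real.exp ((c + 2) * W) := by
      refine setIntegral_mono_on hpint (integrableOn_const hfin)
        isOpen_interior.measurableSet fun x hx => ?_
      exact (expWeight_bounds (by linarith) (hW x (interior_subset hx))).2
    refine this.trans_eq ?_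
    simp [mul_comm]
  -- Of the exponent `c + 2`, the part `c` compensates the growth allowed by `hf` and the part `2`
  -- remains as decay.
  have htr := weighted_transport_le hC hbd hV hVP ha (by linarith : 0 ≤ c + 2) hS.posSemidef hD
  have hVi : ∀ i, Continuous fun x => V x i := fun i =>
    (contDiff_coord hV.contDiff i).continuous
  have hq' : ∀ i, IntegrableOn (fun x => matForm S (D i x) (u x)
      + matForm S (u x) (D i x)) (interior C) := fun i =>
    (integrableOn_matForm S _ _).fun_add (integrableOn_matForm S _ _)
  have hI1 := integrable_continuous_mul hC (contDiff_expWeight a (c + 2)).continuous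
    ((integrable_continuous_mul hC (hVi 0) (hq' 0)).fun_add
      (integrable_continuous_mul hC (hVi 1) (hq' 1)))
  have hI2 := integrable_weightedForm hC a (c + 2) S u u
  have hmain : weightedForm C a (c + 2) S u u' + weightedForm C a (c + 2) S u' u
      ≤ ∫ x in interior C, (c * (expWeight a (c + 2) x * matForm S (u x) (u x))
        + k * expWeight a (c + 2) x - expWeight a (c + 2) x *
        (V x 0 * (matForm S (D 0 x) (u x) + matForm S (u x) (D 0 x))
          + V x 1 * (matForm S (D 1 x) (u x) + matForm S (u x) (D 1 x)))) := by
    have hJ1 := integrable_weightedForm hC a (c + 2) S u u'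
    have hJ2 := integrable_weightedForm hC a (c + 2) S u' u
    rw [weightedForm, weightedForm, ← integral_add hJ1 hJ2]
    refine integral_mono_ae (hJ1.fun_add hJ2)
      (((hI2.const_mul c).fun_add (hpint.const_mul k)).sub hI1) ?_
    filter_upwards [ae_restrict_mem isOpen_interior.measurableSet, heq] with x hx heq
    have hsol : u' x = f x (u x) + ((-V x 0) • D 0 x + (-V x 1) • D 1 x) := by
      rw [← heq]
      module
    have hp : 0 ≤ expWeight a (c + 2) x := (Real.exp_pos _).le
    have hA := mul_le_mul_of_nonneg_left (hf x hx (u x)) hp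
    have e0 : matForm S (u x) (u' x) = matForm S (u x) (f x (u x))
        + (-V x 0 * matForm S (u x) (D 0 x) + -V x 1 * matForm S (u x) (D 1 x)) := by
      rw [hsol, matForm_add_right, matForm_add_right, matForm_smul_right, matForm_smul_right]
    have e1 := matForm_comm hS.isHermitian (u' x) (u x)
    have e2 := matForm_comm hS.isHermitian (D 0 x) (u x)
    have e3 := matForm_comm hS.isHermitian (D 1 x) (u x)
    simp only [e1, e2, e3, e0]
    linarith
  rw [integral_sub ((hI2.const_mul c).fun_add (hpint.const_mul k)) hI1,
    integral_add (hI2.const_mul c) (hpint.const_mul k), integral_const_mul,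
    integral_const_mul] at hmain
  have := mul_le_mul_of_nonneg_left hpvol hk
  change (c + 2) * ∫ x in interior C, expWeight a (c + 2) x * matForm S (u x) (u x) ≤ _ at htr
  change _ ≤ -2 * (∫ x in interior C, expWeight a (c + 2) x * matForm S (u x) (u x)) + _
  linarith

/-- Classical solutions decay exponentially up to the size `k` of the forcing, if the velocity
field leaves `C` at a uniform rate and the right hand side is controlled in the energy. -/
lemma IsClassicalSolution.weightedForm_le (hC : IsCompact C) (hbd : HasPiecewiseC1Boundary C)
    {V : Plane → Plane} (hV : IsTransportField V) (hVP : HasFirstIntegrals V)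
    {a : Plane} (ha : ∀ x ∈ C, inner ℝ a (V x) ≤ -1) {W : ℝ} (hW : ∀ x ∈ C, |inner ℝ a x| ≤ W)
    {S : Matrix (Fin 2) (Fin 2) ℝ} (hS : S.PosDef)
    {A : Plane → ℝ → Matrix (Fin 2) (Fin 2) ℝ} {h : Plane → ℝ → Plane} {z₀ : L2 C}
    {z : ℝ → L2 C} (hz : IsClassicalSolution C V A h z₀ z) {c k : ℝ} (hc : 0 ≤ c) (hk : 0 ≤ k)
    (hAh : ∀ s, 0 < s → ∀ x ∈ interior C, ∀ w : Plane,
      2 * matForm S w (Matrix.toEuclideanLin (A x s) w + h x s) ≤ c * matForm S w w + k)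
    {s : ℝ} (hs : 0 ≤ s) :
    weightedForm C a (c + 2) S (z s) (z s)
      ≤ Real.exp (-(2 * s)) * weightedForm C a (c + 2) S z₀ z₀
        + k * (Real.exp ((c + 2) * W) * volume.real (interior C)) / 2 := by
  obtain ⟨D, -, -, hD0, hDeq⟩ := hz.equation
  have hzc := hz.contDiffOn.continuousOn
  have hEd : ∀ t, 0 < t → HasDerivAt (fun t => weightedForm C a (c + 2) S (z t) (z t))
      (weightedForm C a (c + 2) S (z t) (deriv z t)
        + weightedForm C a (c + 2) S (deriv z t) (z t)) t := fun t ht =>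
    hasDerivAt_weightedForm hC a (c + 2) S
      ((hz.contDiffOn.contDiffAt (Ici_mem_nhds ht)).differentiableAt one_ne_zero).hasDerivAt
  have hEc : ContinuousOn (fun t => weightedForm C a (c + 2) S (z t) (z t)) (Ici 0) :=
    (continuous_weightedForm_self hC a (c + 2) S).comp_continuousOn hzc
  have hle := fun (t : ℝ) (ht : 0 < t) => weightedForm_deriv_le hC hbd hV hVP ha hW hS
    (f := fun x w => Matrix.toEuclideanLin (A x t) w + h x t) (hD0 t ht) (hDeq t ht) hc hk
    (hAh t ht)
  have := le_exp_neg_two_mul_add hEc hEd hle (mul_nonneg hk (by positivity)) hs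
  rwa [hz.initial] at this

/-- On `C` the weight lies between `exp (-(c+2)W)` and `exp ((c+2)W)`, so energy and squared norm
are comparable. The square root halves both the rate `2` and the weight ratio `exp (2(c+2)W)`. The
forcing enters as `k ^ 2` so that `k` appears linearly afterwards. -/
lemma IsClassicalSolution.norm_le (hC : IsCompact C) (hbd : HasPiecewiseC1Boundary C)
    {V : Plane → Plane} (hV : IsTransportField V) (hVP : HasFirstIntegrals V)
    {a : Plane} (ha : ∀ x ∈ C, inner ℝ a (V x) ≤ -1) {W : ℝ}
    (hW : ∀ x ∈ C, |inner ℝ a x| ≤ W)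
    {S : Matrix (Fin 2) (Fin 2) ℝ} (hS : S.PosDef) {σ : ℝ} (hσ : 0 < σ)
    (hSσ : ∀ v, σ * ‖v‖ ^ 2 ≤ matForm S v v)
    {A : Plane → ℝ → Matrix (Fin 2) (Fin 2) ℝ} {h : Plane → ℝ → Plane} {z₀ : L2 C}
    {z : ℝ → L2 C} (hz : IsClassicalSolution C V A h z₀ z) {c k : ℝ} (hc : 0 ≤ c) (hk : 0 ≤ k)
    (hAh : ∀ s, 0 < s → ∀ x ∈ interior C, ∀ w : Plane,
      2 * matForm S w (Matrix.toEuclideanLin (A x s) w + h x s) ≤ c * matForm S w w + k ^ 2)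
    {s : ℝ} (hs : 0 ≤ s) :
    ‖z s‖ ≤ Real.exp ((c + 2) * W) * (√(matNorm S / σ) * ‖z₀‖ * Real.exp (-s)
      + √(volume.real (interior C) / (2 * σ)) * k) := by
  have h1 := hz.weightedForm_le hC hbd hV hVP ha hW hS hc (sq_nonneg k) hAh hs
  have hc2 : 0 ≤ c + 2 := by linarith
  have h2 := le_weightedForm hC hc2 hW hσ hSσ (z s)
  have h3 := mul_le_mul_of_nonneg_left (_root_.weightedForm_le hC hc2 hW S z₀)
    (Real.exp_pos (-(2 * s))).le
  have hN := matNorm_nonneg S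
  set e := Real.exp ((c + 2) * W) with he
  have he0 : 0 < e := Real.exp_pos _
  have heinv : Real.exp (-((c + 2) * W)) = e⁻¹ := Real.exp_neg _
  have hes : Real.exp (-(2 * s)) = Real.exp (-s) ^ 2 := by
    rw [← Real.exp_nat_mul]; congr 1; push_cast; ring
  rw [heinv] at h2
  rw [hes] at h1 h3
  set v := volume.real (interior C) with hv
  have hv0 : 0 ≤ v := measureReal_nonneg
  set r := Real.exp (-s) with hr
  have hr0 : 0 < r := Real.exp_pos _
  have hs1 : √(matNorm S / σ) ^ 2 = matNorm S / σ := Real.sq_sqrt (by positivity)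
  have hs2 : √(v / (2 * σ)) ^ 2 = v / (2 * σ) := Real.sq_sqrt (by positivity)
  have hsq : ‖z s‖ ^ 2
      ≤ e ^ 2 * ((√(matNorm S / σ) * ‖z₀‖ * r) ^ 2 + (√(v / (2 * σ)) * k) ^ 2) := by
    have h4 : σ * e⁻¹ * ‖z s‖ ^ 2
        ≤ r ^ 2 * (matNorm S * e * ‖z₀‖ ^ 2) + k ^ 2 * (e * v) / 2 := by linarith
    have h5 : ‖z s‖ ^ 2 = (e / σ) * (σ * e⁻¹ * ‖z s‖ ^ 2) := by field_simp
    rw [h5]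
    refine (mul_le_mul_of_nonneg_left h4 (by positivity)).trans_eq ?_
    rw [mul_pow, mul_pow, mul_pow, hs1, hs2]
    field_simp
  refine (le_abs_self _).trans (abs_le_of_sq_le_sq (b := e * (√(matNorm S / σ) * ‖z₀‖ * r
    + √(v / (2 * σ)) * k)) (hsq.trans ?_) (by positivity))
  rw [mul_pow e]
  refine mul_le_mul_of_nonneg_left ?_ (sq_nonneg e)
  have : 0 ≤ √(matNorm S / σ) * ‖z₀‖ * r * (√(v / (2 * σ)) * k) := by positivity
  linarith [add_sq (√(matNorm S / σ) * ‖z₀‖ * r) (√(v / (2 * σ)) * k)]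

end Decay

/-! ### Bounds for the friction model -/

section Friction

open Matrix

namespace FrictionData

variable (P : FrictionData)

lemma slipNorm_nonneg (y : Plane) : 0 ≤ P.slipNorm y :=
  P.isNormRegularisation.nonneg _ P.eps_nonneg _

lemma continuous_slipNorm : Continuous P.slipNorm := by
  refine (P.isNormRegularisation.continuous _ P.eps_nonneg).comp ?_
  have hM := P.continuous_M
  refine (PiLp.continuous_toLp 2 _).comp ?_
  exact hM.matrix_mulVec (PiLp.continuous_ofLp 2 _)

lemma posDef_G (y : Plane) : (P.G y).PosDef := by
  have hM : (P.M y ^ 2).PosDef := by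
    have h := Matrix.PosDef.conjTranspose_mul_self (P.M y)
      (Matrix.mulVec_injective_of_isUnit (P.posDef_M y).isUnit)
    rwa [(P.posDef_M y).isHermitian.eq, ← sq] at h
  exact hM.posSemidef_add (P.posSemidef_Sig1.smul (P.slipNorm_nonneg y))

lemma continuous_G : Continuous P.G :=
  (P.continuous_slipNorm.smul continuous_const).add (P.continuous_M.pow 2)

lemma continuous_inv_G : Continuous fun y => (P.G y)⁻¹ := by
  have h : ∀ y, (P.G y)⁻¹ = (P.G y).det⁻¹ • (P.G y).adjugate := fun y => by
    rw [Matrix.inv_def, Ring.inverse_eq_inv']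
  simp_rw [h]
  exact (P.continuous_G.matrix_det.inv₀ fun y => (P.posDef_G y).det_pos.ne').smul
    P.continuous_G.matrix_adjugate

/-- `-G(y)⁻¹ M(y)²` as a function of `y = V_r v`. -/
def frictionMatrix (y : Plane) : Matrix (Fin 2) (Fin 2) ℝ := -((P.G y)⁻¹ * P.M y ^ 2)

lemma continuous_matNorm_frictionMatrix : Continuous fun y => matNorm (P.frictionMatrix y) := by
  have h1 : Continuous P.frictionMatrix :=
    (P.continuous_inv_G.mul (P.continuous_M.pow 2)).neg
  have h2 : Continuous fun S : Matrix (Fin 2) (Fin 2) ℝ =>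
      LinearMap.toContinuousLinearMap (Matrix.toEuclideanLin S) :=
    LinearMap.continuous_of_finiteDimensional
      ((LinearMap.toContinuousLinearMap (𝕜 := ℝ) (E := Plane) (F' := Plane)).toLinearMap ∘ₗ
        (Matrix.toEuclideanLin (𝕜 := ℝ) (m := Fin 2) (n := Fin 2)).toLinearMap)
  exact (h2.comp h1).norm

/-- The supremum of the norm of `frictionMatrix` over the ball of radius `r`. -/
def frictionBound (r : ℝ) : ℝ :=
  sSup ((fun x => matNorm (P.frictionMatrix (r • x))) '' Metric.closedBall 0 1)

/-- Writing the ball of radius `r` as `r • x` with `x` in the unit ball keeps the compact index set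
fixed, and the supremum of a jointly continuous function over it is continuous in `r`. -/
lemma continuous_frictionBound : Continuous P.frictionBound := by
  refine (isCompact_closedBall (0 : Plane) 1).continuous_sSup ?_
  exact P.continuous_matNorm_frictionMatrix.comp (continuous_fst.smul continuous_snd)

lemma bddAbove_frictionMatrix (r : ℝ) :
    BddAbove ((fun x => matNorm (P.frictionMatrix (r • x))) '' Metric.closedBall 0 1) := by
  have h : Continuous fun x : Plane => matNorm (P.frictionMatrix (r • x)) :=
    P.continuous_matNorm_frictionMatrix.comp (continuous_const_smul r)
  exact (isCompact_closedBall (0 : Plane) 1).bddAbove_image h.continuousOn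

lemma matNorm_frictionMatrix_le {r : ℝ} {y : Plane} (hy : ‖y‖ ≤ r) :
    matNorm (P.frictionMatrix y) ≤ P.frictionBound r := by
  refine le_csSup (P.bddAbove_frictionMatrix r) ?_
  rcases eq_or_ne r 0 with rfl | hr
  · exact ⟨0, by simp, by simp [norm_le_zero_iff.1 hy]⟩
  · have hr0 : 0 < r := lt_of_le_of_ne ((norm_nonneg y).trans hy) hr.symm
    refine ⟨r⁻¹ • y, ?_, by simp [smul_smul, mul_inv_cancel₀ hr]⟩
    rw [mem_closedBall_zero_iff, norm_smul, norm_inv, Real.norm_of_nonneg hr0.le,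
      inv_mul_le_iff₀ hr0, mul_one]
    exact hy

lemma frictionBound_nonneg {r : ℝ} (hr : 0 ≤ r) : 0 ≤ P.frictionBound r :=
  (matNorm_nonneg _).trans (P.matNorm_frictionMatrix_le (y := 0) (by simpa using hr))

lemma monotoneOn_frictionBound : MonotoneOn P.frictionBound (Ici 0) := by
  intro r hr r' _ hrr
  refine csSup_le ⟨_, 0, by simp, rfl⟩ ?_
  rintro _ ⟨x, hx, rfl⟩
  refine P.matNorm_frictionMatrix_le ?_
  rw [norm_smul, Real.norm_of_nonneg hr]
  have := mem_closedBall_zero_iff.1 hx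
  nlinarith [mem_Ici.1 hr, norm_nonneg x]

/-- This is why `Σ₀` weights the energy: `⟨w, Σ₀ G⁻¹ Σ₀ w⟩` is the form of `G⁻¹` at `Σ₀ w`, whereas
`G⁻¹ Σ₀` alone need not be positive for the Euclidean product. -/
lemma matForm_SigMat_nonpos {Vr : ℝ} (hVr : 0 ≤ Vr) (v w : Plane) :
    matForm P.Sig0 w (Matrix.toEuclideanLin (P.SigMat Vr v) w) ≤ 0 := by
  rw [matForm_comm P.posDef_Sig0.isHermitian, matForm_eq_dotProduct]
  have h := (P.posDef_G (Vr • v)).inv.posSemidef.dotProduct_mulVec_nonneg (P.Sig0 *ᵥ w.ofLp)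
  have hc : 0 ≤ 1 / Vr * P.slipNorm (Vr • v) :=
    mul_nonneg (one_div_nonneg.2 hVr) (P.slipNorm_nonneg _)
  have e : (Matrix.toEuclideanLin (P.SigMat Vr v) w).ofLp
      = -((1 / Vr * P.slipNorm (Vr • v)) • ((P.G (Vr • v))⁻¹ *ᵥ (P.Sig0 *ᵥ w.ofLp))) := by
    rw [Matrix.ofLp_toLpLin, Matrix.toLin'_apply, SigMat, neg_mulVec, smul_mulVec,
      mulVec_mulVec]
  rw [e, neg_dotProduct, smul_dotProduct, dotProduct_comm, smul_eq_mul]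
  simp only [star_trivial] at h
  have := mul_nonneg hc h
  linarith

end FrictionData

lemma norm_spinMatrix (φ : ℝ) (w : Plane) :
    ‖Matrix.toEuclideanLin (spinMatrix φ) w‖ = |φ| * ‖w‖ := by
  rw [EuclideanSpace.norm_eq, EuclideanSpace.norm_eq, ← Real.sqrt_sq_eq_abs,
    ← Real.sqrt_mul (sq_nonneg φ)]
  congr 1
  simp [Fin.sum_univ_two, spinMatrix, Matrix.ofLp_toLpLin, Matrix.toLin'_apply, mulVec, dotProduct]
  ring

/-- The `Σ` term is dropped by its sign, the spin term is bounded by a multiple of the energy, and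
the forcing is split by Young's inequality, which accounts for the `+ 1`. The radius `Vmax * R`
bounds the argument `V_r v` of the friction matrix. -/
lemma matForm_rhs_le (P : FrictionData) {σ : ℝ} (hσ : 0 < σ)
    (hS : ∀ v, σ * ‖v‖ ^ 2 ≤ matForm P.Sig0 v v) {Vr Vmax R η φ Φ : ℝ} (hVr : 0 ≤ Vr)
    (hVr' : Vr ≤ Vmax) {v : Plane} (hv : ‖v‖ ≤ R) (hη : P.frictionBound (Vmax * R) = η)
    (hφ : |φ| ≤ Φ) (w : Plane) :
    2 * matForm P.Sig0 w (Matrix.toEuclideanLin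
        (P.SigMat Vr v - P.HMat Vr v * spinMatrix φ) w + P.hVec Vr v)
      ≤ (2 * (matNorm P.Sig0 / σ * Φ * η) + 1) * matForm P.Sig0 w w
        + (matNorm P.Sig0 / √σ * (η * R)) ^ 2 := by
  have hN := matNorm_nonneg P.Sig0
  have hR : 0 ≤ R := (norm_nonneg v).trans hv
  have hη' : matNorm (P.HMat Vr v) ≤ η := by
    rw [← hη]
    refine P.matNorm_frictionMatrix_le (y := Vr • v) ?_
    rw [norm_smul, Real.norm_of_nonneg hVr]
    exact mul_le_mul hVr' hv (norm_nonneg _) (hVr.trans hVr')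
  have hη0 : 0 ≤ η := (matNorm_nonneg _).trans hη'
  have hΦ : 0 ≤ Φ := (abs_nonneg _).trans hφ
  have h1 := P.matForm_SigMat_nonpos hVr v w
  have h2 : |matForm P.Sig0 w (Matrix.toEuclideanLin (P.HMat Vr v * spinMatrix φ) w)|
      ≤ matNorm P.Sig0 / σ * Φ * η * matForm P.Sig0 w w := by
    have e : Matrix.toEuclideanLin (P.HMat Vr v * spinMatrix φ) w
        = Matrix.toEuclideanLin (P.HMat Vr v) (Matrix.toEuclideanLin (spinMatrix φ) w) := by
      ext i
      simp [Matrix.ofLp_toLpLin, Matrix.toLin'_apply]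
    have hb : ‖Matrix.toEuclideanLin (P.HMat Vr v * spinMatrix φ) w‖ ≤ η * (Φ * ‖w‖) := by
      rw [e]
      refine (norm_toEuclideanLin_le _ _).trans ?_
      rw [norm_spinMatrix]
      gcongr
    calc _ ≤ matNorm P.Sig0 * (‖w‖ * (η * (Φ * ‖w‖))) :=
          (abs_matForm_le _ _ _).trans (by gcongr)
      _ = matNorm P.Sig0 / σ * Φ * η * (σ * ‖w‖ ^ 2) := by field_simp
      _ ≤ _ := mul_le_mul_of_nonneg_left (hS w) (by positivity)
  have h3 : 2 * matForm P.Sig0 w (P.hVec Vr v)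
      ≤ matForm P.Sig0 w w + (matNorm P.Sig0 / √σ * (η * R)) ^ 2 := by
    have hb : ‖P.hVec Vr v‖ ≤ η * R :=
      (norm_toEuclideanLin_le _ _).trans (by gcongr)
    have hle : matForm P.Sig0 w (P.hVec Vr v) ≤ matNorm P.Sig0 * (‖w‖ * (η * R)) :=
      (le_abs_self _).trans ((abs_matForm_le _ _ _).trans (by gcongr))
    have hsq : √σ ^ 2 = σ := Real.sq_sqrt hσ.le
    have hs0 : √σ ≠ 0 := (Real.sqrt_pos.2 hσ).ne'
    -- The split is scaled by `√σ` so that the first square `σ ‖w‖²` is at most the energy density.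
    have e : matNorm P.Sig0 * (‖w‖ * (η * R))
        = (√σ * ‖w‖) * (matNorm P.Sig0 / √σ * (η * R)) := by field_simp
    have h4 := two_mul_le_add_sq (√σ * ‖w‖) (matNorm P.Sig0 / √σ * (η * R))
    rw [mul_pow (√σ), hsq] at h4
    have := hS w
    rw [e] at hle
    linarith
  rw [map_sub, LinearMap.sub_apply, sub_eq_add_neg, matForm_add_right, matForm_add_right,
    ← neg_one_smul ℝ (Matrix.toEuclideanLin (P.HMat Vr v * spinMatrix φ) w), matForm_smul_right]
  have := (abs_le.1 h2).1
  linarith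

end Friction

/-! ### From exponential estimates to comparison functions -/

/-- A continuous function exceeding its essential supremum at a point of an open set would do so on
a nonempty open set, which has positive measure. -/
lemma norm_le_slipSup {C : Set Plane} {v : Plane → ℝ → Plane} (hv : IsSlipInput C v)
    {x : Plane} (hx : x ∈ interior C) {s : ℝ} (hs : 0 < s) : ‖v x s‖ ≤ slipSup C v := by
  obtain ⟨hd, hm⟩ := hv
  by_contra! hlt
  have hsub : interior C ×ˢ Ioi (0 : ℝ) ⊆ C ×ˢ Ici 0 :=
    prod_mono interior_subset Ioi_subset_Ici_self
  have hopen : IsOpen (interior C ×ˢ Ioi (0 : ℝ)) := isOpen_interior.prod isOpen_Ioi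
  have hO : IsOpen ((interior C ×ˢ Ioi (0 : ℝ)) ∩
      (fun p => ‖Function.uncurry v p‖) ⁻¹' Ioi (slipSup C v)) :=
    (hd.continuousOn.mono hsub).norm.isOpen_inter_preimage hopen isOpen_Ioi
  have hpos := hO.measure_pos volume ⟨(x, s), ⟨hx, hs⟩, hlt⟩
  refine hpos.ne' ?_
  have hae : ∀ᵐ p ∂((volume : Measure (Plane × ℝ)).restrict (interior C ×ˢ Ioi (0 : ℝ))),
      ‖Function.uncurry v p‖ ≤ slipSup C v := by
    refine ae_restrict_of_ae_restrict_of_subset hsub ?_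
    have hfin : eLpNormEssSup (Function.uncurry v)
        ((volume : Measure (Plane × ℝ)).restrict (C ×ˢ Ici 0)) ≠ ⊤ := by
      rw [← eLpNorm_exponent_top]
      exact hm.eLpNorm_ne_top
    filter_upwards [enorm_ae_le_eLpNormEssSup (Function.uncurry v)
      ((volume : Measure (Plane × ℝ)).restrict (C ×ˢ Ici 0))] with p hp
    have := ENNReal.toReal_mono hfin hp
    simpa [slipSup] using this
  rw [ae_restrict_iff' hopen.measurableSet, ae_iff] at hae
  refine measure_mono_null (fun p hp => ?_) hae
  simp only [mem_ofPred_eq, not_forall, not_le]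
  exact ⟨hp.1, hp.2⟩

lemma isClassKL_of_exp {κ : ℝ} (hκ : 0 < κ) :
    IsClassKL fun r t => (κ * r + r ^ 2 / 2) * Real.exp (-t) := by
  refine ⟨?_, fun t _ => ⟨?_, ?_, by simp⟩, fun r hr => ?_, fun r _ => ?_⟩
  · exact Continuous.continuousOn (by fun_prop)
  · exact Continuous.continuousOn (by fun_prop)
  · intro r hr r' hr' hlt
    have h0 := mem_Ici.1 hr
    refine mul_lt_mul_of_pos_right ?_ (Real.exp_pos _)
    nlinarith
  · intro t _ t' _ hlt
    exact mul_lt_mul_of_pos_left (Real.exp_lt_exp.2 (neg_lt_neg hlt)) (by positivity)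
  · have := (Real.tendsto_exp_neg_atTop_nhds_zero).const_mul (κ * r + r ^ 2 / 2)
    simpa using this

/-- The summand `R` supplies strict monotonicity and unboundedness. Subtracting `K 0` makes the
function vanish at `0`. -/
lemma isClassKInf_of_monotoneOn {K ζ : ℝ → ℝ} (hK : ContinuousOn K (Ici 0))
    (hKm : MonotoneOn K (Ici 0)) (hζ : ContinuousOn ζ (Ici 0)) (hζm : MonotoneOn ζ (Ici 0))
    (hζ0 : ζ 0 = 0) : IsClassKInf fun R => (K R - K 0) ^ 2 / 2 + ζ R + R := by
  have h0 : (0 : ℝ) ∈ Ici (0 : ℝ) := self_mem_Ici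
  refine ⟨⟨?_, ?_, by simp [hζ0]⟩, fun b => ⟨max b 0 + 1, by positivity, ?_⟩⟩
  · exact (((((hK.sub continuousOn_const).pow 2).div_const 2)).add hζ).add continuousOn_id
  · intro R hR R' hR' hlt
    have h1 := hKm hR hR' hlt.le
    have h2 := hKm h0 hR hR
    have h3 := hζm hR hR' hlt.le
    simp only
    nlinarith
  · have hm : max b 0 + 1 ∈ Ici (0 : ℝ) := mem_Ici.2 (by positivity)
    have h1 := hζm h0 hm hm
    rw [hζ0] at h1
    have h2 := le_max_left b 0
    have h3 := sq_nonneg (K (max b 0 + 1) - K 0)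
    linarith

/-- Write `K r = K₀ r + (K - K₀) r`, apply Young's inequality to the last product and use `exp (-s)
≤ 1` on its `(K - K₀)²` part. This separates the initial state from the input. -/
lemma mul_exp_le_comparison {K K₀ r s : ℝ} (hs : 0 ≤ s) :
    K * r * Real.exp (-s)
      ≤ (K₀ * r + r ^ 2 / 2) * Real.exp (-s) + (K - K₀) ^ 2 / 2 := by
  have h1 : Real.exp (-s) ≤ 1 := Real.exp_le_one_iff.2 (by linarith)
  have h0 := Real.exp_pos (-s)
  have h2 := mul_nonneg h0.le (sq_nonneg (K - K₀ - r))
  have h3 := mul_le_mul_of_nonneg_right h1 (sq_nonneg (K - K₀))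
  nlinarith

/-- The overshoot at zero input stays in `β`, and its excess at input size `R` is paid by `γ`. -/
lemma exists_gains {η : ℝ → ℝ} (hηc : Continuous η) (hη0 : ∀ R, 0 ≤ R → 0 ≤ η R)
    (hηm : MonotoneOn η (Ici 0)) {ρ W l m : ℝ} (hρ : 0 ≤ ρ) (hW : 0 ≤ W) (hl : 0 ≤ l)
    (hm : 0 ≤ m) :
    ∃ (β : ℝ → ℝ → ℝ) (γ : ℝ → ℝ), IsClassKL β ∧ IsClassKInf γ ∧
      ∀ r R s : ℝ, 0 ≤ r → 0 ≤ R → 0 ≤ s →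
        Real.exp ((2 * (ρ * η R) + 1 + 2) * W) * (l * r * Real.exp (-s) + m * (η R * R))
          ≤ β r s + γ R := by
  have hLm : ∀ R R', 0 ≤ R → R ≤ R' → Real.exp ((2 * (ρ * η R) + 1 + 2) * W)
      ≤ Real.exp ((2 * (ρ * η R') + 1 + 2) * W) := fun R R' hR hle => by
    have := hηm (mem_Ici.2 hR) (mem_Ici.2 (hR.trans hle)) hle
    gcongr
  obtain ⟨L, hL⟩ : ∃ L : ℝ → ℝ, L = fun R => Real.exp ((2 * (ρ * η R) + 1 + 2) * W) := ⟨_, rfl⟩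
  have hLc : Continuous L := by rw [hL]; fun_prop
  have hL0 : ∀ R, 0 ≤ L R := fun R => by rw [hL]; positivity
  have hLm' : ∀ R R', 0 ≤ R → R ≤ R' → L R ≤ L R' := by rw [hL]; exact hLm
  have hKm : MonotoneOn (fun R => L R * l) (Ici 0) := fun R hR R' _ hle =>
    mul_le_mul_of_nonneg_right (hLm' R R' hR hle) hl
  have hζm : MonotoneOn (fun R => L R * (m * (η R * R))) (Ici 0) := fun R hR R' hR' hle => by
    have h2 := hηm hR hR' hle
    have h3 := hη0 R' hR'
    have h4 := hη0 R hR
    have h5 := mem_Ici.1 hR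
    exact mul_le_mul (hLm' R R' hR hle) (mul_le_mul_of_nonneg_left
      (mul_le_mul h2 hle h5 h3) hm) (by positivity) (hL0 R')
  refine ⟨_, _, isClassKL_of_exp (κ := L 0 * l + 1) (by have := hL0 0; positivity),
    isClassKInf_of_monotoneOn (Continuous.continuousOn (by fun_prop)) hKm
      (Continuous.continuousOn (by fun_prop)) hζm (by simp), fun r R s hr hR hs => ?_⟩
  have hcomp := mul_exp_le_comparison (K := L R * l) (K₀ := L 0 * l) (r := r) hs
  have hexp : 0 ≤ r * Real.exp (-s) := by positivity
  rw [show Real.exp ((2 * (ρ * η R) + 1 + 2) * W) = L R by rw [hL]]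
  linarith

/-- Uniform input-to-state stability for a transport field that leaves `C` at a uniform rate. -/
lemma inputToState_of_transport (P : FrictionData) {C : Set Plane} (hC : IsCompact C)
    (hbd : HasPiecewiseC1Boundary C) {Vmin Vmax : ℝ} (hVmin : 0 < Vmin) (hVV : Vmin ≤ Vmax)
    {V : Plane → Plane} (hV : IsTransportField V) (hVP : HasFirstIntegrals V)
    {a : Plane} (ha : ∀ x ∈ C, inner ℝ a (V x) ≤ -1) {Φ : ℝ} (hΦ : 0 ≤ Φ) :
    ∃ (β : ℝ → ℝ → ℝ) (γ : ℝ → ℝ), IsClassKL β ∧ IsClassKInf γ ∧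
      ∀ (v : Plane → ℝ → Plane) (Vr φ₂ : ℝ → ℝ) (z₀ : L2 C) (z : ℝ → L2 C),
        IsSlipInput C v → IsRollingSpeed Vmin Vmax Vr → (∀ s : ℝ, 0 ≤ s → |φ₂ s| ≤ Φ) →
        IsClassicalSolution C V
          (fun x s => P.SigMat (Vr s) (v x s) - P.HMat (Vr s) (v x s) * spinMatrix (φ₂ s))
          (fun x s => P.hVec (Vr s) (v x s)) z₀ z →
        ∀ s : ℝ, 0 ≤ s → ‖z s‖ ≤ β ‖z₀‖ s + γ (slipSup C v) := by
  obtain ⟨σ, hσ, hSσ⟩ := exists_matForm_lower_bound P.posDef_Sig0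
  obtain ⟨W₀, hW₀⟩ := hC.exists_bound_of_continuousOn
    (f := fun x : Plane => (inner ℝ a x : ℝ)) (continuous_const.inner continuous_id).continuousOn
  have hW : ∀ x ∈ C, |inner ℝ a x| ≤ max W₀ 0 := fun x hx => (hW₀ x hx).trans (le_max_left _ _)
  have hN := matNorm_nonneg P.Sig0
  have hVmax : 0 ≤ Vmax := hVmin.le.trans hVV
  have hηc : Continuous fun R => P.frictionBound (Vmax * R) :=
    P.continuous_frictionBound.comp (continuous_const_mul Vmax)
  have hη0 : ∀ R, 0 ≤ R → 0 ≤ P.frictionBound (Vmax * R) := fun R hR =>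
    P.frictionBound_nonneg (mul_nonneg hVmax hR)
  have hηm : MonotoneOn (fun R => P.frictionBound (Vmax * R)) (Ici 0) := fun R hR R' hR' hle =>
    P.monotoneOn_frictionBound (mul_nonneg hVmax hR) (mul_nonneg hVmax hR')
      (mul_le_mul_of_nonneg_left hle hVmax)
  have hρ : 0 ≤ matNorm P.Sig0 / σ * Φ := by positivity
  obtain ⟨β, γ, hβ, hγ, hβγ⟩ := exists_gains hηc hη0 hηm hρ (le_max_right W₀ 0)
    (Real.sqrt_nonneg (matNorm P.Sig0 / σ))
    (m := √(volume.real (interior C) / (2 * σ)) * (matNorm P.Sig0 / √σ)) (by positivity)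
  refine ⟨β, γ, hβ, hγ, fun v Vr φ₂ z₀ z hv hVr hφ hz s hs => ?_⟩
  have hR : 0 ≤ slipSup C v := ENNReal.toReal_nonneg
  have hηR := hη0 _ hR
  -- The weight is adapted to the given input, with `c` and `k` read off from `matForm_rhs_le`.
  have hmain := hz.norm_le hC hbd hV hVP ha hW P.posDef_Sig0 hσ hSσ
    (c := 2 * (matNorm P.Sig0 / σ * Φ * P.frictionBound (Vmax * slipSup C v)) + 1)
    (k := matNorm P.Sig0 / √σ * (P.frictionBound (Vmax * slipSup C v) * slipSup C v))
    (by positivity) (by positivity)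
    (fun t ht x hx w => matForm_rhs_le P hσ hSσ (hVmin.le.trans (hVr.2 t ht.le).1)
      (hVr.2 t ht.le).2 (norm_le_slipSup hv hx ht) rfl (hφ t ht.le) w) hs
  refine hmain.trans (le_of_eq_of_le ?_ (hβγ ‖z₀‖ (slipSup C v) s (norm_nonneg _) hR hs))
  ring

/-! ### The two transport fields -/

/-- Any function of a first integral is one too. The product of the squares `(t - f y)²` over `y ∈
F`, evaluated at `t = f x`, vanishes only on finitely many level sets. -/
lemma hasFirstIntegrals_of_levels {V : Plane → Plane} {f : Plane → ℝ} (hf : ContDiff ℝ 1 f)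
    (hfV : ∀ x, fderiv ℝ f x (V x) = 0) (hnull : ∀ c, volume {x | f x = c} = 0) :
    HasFirstIntegrals V := by
  intro F hF
  set g : ℝ → ℝ := fun t => ∏ y ∈ hF.toFinset, (t - f y) ^ 2 with hg
  have hgc : ContDiff ℝ 1 g := contDiff_prod fun y _ => (contDiff_id.sub contDiff_const).pow 2
  refine ⟨fun x => g (f x), hgc.comp hf, fun x => Finset.prod_nonneg fun y _ => sq_nonneg _,
    fun x => ?_, fun x hx => ?_, ?_⟩
  · have h1 := (hgc.differentiable one_ne_zero (f x)).hasDerivAt.comp_hasFDerivAt x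
      (hf.differentiable one_ne_zero x).hasFDerivAt
    have h2 : fderiv ℝ (fun x => g (f x)) x = _ := h1.fderiv
    rw [h2]
    simp [hfV]
  · exact Finset.prod_eq_zero (hF.mem_toFinset.2 hx) (by simp)
  · have hsub : {x | g (f x) = 0} ⊆ ⋃ y ∈ F, {x | f x = f y} := by
      intro x hx
      obtain ⟨y, hy, hxy⟩ := Finset.prod_eq_zero_iff.1 hx
      refine mem_iUnion₂.2 ⟨y, hF.mem_toFinset.1 hy, ?_⟩
      exact sub_eq_zero.1 (pow_eq_zero_iff two_ne_zero |>.1 hxy)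
    exact measure_mono_null hsub ((measure_biUnion_null_iff hF.countable).2 fun y _ => hnull _)

lemma isTransportField_standardVelocity : IsTransportField standardVelocity :=
  ⟨contDiff_const, fun i x => by simp [standardVelocity]⟩

lemma volume_coord_eq (i : Fin 2) (c : ℝ) : volume {x : Plane | x i = c} = 0 := by
  have h := (PiLp.volume_preserving_ofLp (Fin 2)).measure_preimage
    (s := {f : Fin 2 → ℝ | f i = c})
    (measurableSet_eq_fun (measurable_pi_apply i) measurable_const).nullMeasurableSet
  refine h.trans ?_
  rw [volume_pi]
  exact Measure.pi_hyperplane (fun _ : Fin 2 => (volume : Measure ℝ)) i c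

lemma hasFirstIntegrals_standardVelocity : HasFirstIntegrals standardVelocity := by
  refine hasFirstIntegrals_of_levels (f := fun x => x 1) (contDiff_coord contDiff_id 1)
    (fun x => ?_) (volume_coord_eq 1)
  have h : HasFDerivAt (fun x : Plane => x 1) (EuclideanSpace.proj (𝕜 := ℝ) 1) x :=
    (EuclideanSpace.proj (𝕜 := ℝ) (1 : Fin 2) : Plane →L[ℝ] ℝ).hasFDerivAt
  rw [h.fderiv]
  simp [standardVelocity]

lemma spinVelocity_zero (e : Plane) (φ : ℝ) (x : Plane) :
    spinVelocity e φ x 0 = -e 1 + φ * x 1 := by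
  simp [spinVelocity, Matrix.ofLp_toLpLin, Matrix.toLin'_apply, Matrix.mulVec, dotProduct,
    Fin.sum_univ_two]

lemma spinVelocity_one (e : Plane) (φ : ℝ) (x : Plane) :
    spinVelocity e φ x 1 = e 0 - φ * x 0 := by
  simp [spinVelocity, Matrix.ofLp_toLpLin, Matrix.toLin'_apply, Matrix.mulVec, dotProduct,
    Fin.sum_univ_two]
  ring

lemma isTransportField_spinVelocity (e : Plane) (φ : ℝ) :
    IsTransportField (spinVelocity e φ) := by
  have hp : ∀ (i : Fin 2) (x : Plane),
      HasFDerivAt (fun x : Plane => x i) (EuclideanSpace.proj (𝕜 := ℝ) i) x := fun i x =>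
    (EuclideanSpace.proj (𝕜 := ℝ) i : Plane →L[ℝ] ℝ).hasFDerivAt
  refine ⟨contDiff_const.add
    (LinearMap.toContinuousLinearMap (Matrix.toEuclideanLin !![0, φ; -φ, 0])).contDiff,
    fun i x => ?_⟩
  fin_cases i
  · simp only [Fin.zero_eta, spinVelocity_zero]
    rw [(((hp 1 x).const_mul φ).const_add (-e 1)).fderiv]
    simp
  · simp only [Fin.mk_one, spinVelocity_one]
    rw [(((hp 0 x).const_mul φ).const_sub (e 0)).fderiv]
    simp

lemma inner_plane (v w : Plane) : inner ℝ v w = v 0 * w 0 + v 1 * w 1 := by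
  simp [PiLp.inner_apply, Fin.sum_univ_two, mul_comm]

/-- The flow is a rotation about `e / φ`, so the distance to that centre is conserved and the level
sets are null circles. -/
lemma hasFirstIntegrals_spinVelocity (e : Plane) {φ : ℝ} (hφ : φ ≠ 0) :
    HasFirstIntegrals (spinVelocity e φ) := by
  refine hasFirstIntegrals_of_levels (f := fun x => ‖x - (1 / φ) • e‖ ^ 2)
    ((contDiff_id.sub contDiff_const).norm_sq ℝ) (fun x => ?_) fun c => ?_
  · have h := ((hasFDerivAt_id x).sub_const ((1 / φ) • e)).norm_sq
    have h' : fderiv ℝ (fun x : Plane => ‖x - (1 / φ) • e‖ ^ 2) x = _ := h.fderiv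
    rw [h']
    simp only [id_eq, _root_.smul_apply, ContinuousLinearMap.comp_apply,
      ContinuousLinearMap.id_apply, innerSL_apply_apply, inner_plane, spinVelocity_zero,
      spinVelocity_one, PiLp.sub_apply, PiLp.smul_apply, smul_eq_mul, nsmul_eq_mul]
    field_simp
    ring
  · refine measure_mono_null (t := Metric.sphere ((1 / φ) • e) √c) (fun x hx => ?_)
      (Measure.addHaar_sphere volume _ _)
    rw [mem_sphere_iff_norm, ← mem_ofPred_eq.mp hx, Real.sqrt_sq (norm_nonneg _)]

/-- The velocity is `φ` times `x - e / φ` turned clockwise by a right angle. Turning `ν` in the same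
way and dividing by `φ η` gives `⟨a, V⟩ = ⟨ν, x - e / φ⟩ / η`. -/
lemma inner_spinVelocity_le {C : Set Plane} {e : Plane} {φ : ℝ} (hφ : φ ≠ 0) {ν : Plane} {η : ℝ}
    (hη : 0 < η) (hν : ∀ x ∈ C, inner ℝ ν (x - (1 / φ) • e) < -η) :
    ∀ x ∈ C, inner ℝ (!₂[ν 1 / (φ * η), -ν 0 / (φ * η)] : Plane) (spinVelocity e φ x) ≤ -1 := by
  intro x hx
  have h := hν x hx
  rw [inner_plane] at h
  have e1 : inner ℝ (!₂[ν 1 / (φ * η), -ν 0 / (φ * η)] : Plane) (spinVelocity e φ x)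
      = (ν 0 * (x - (1 / φ) • e) 0 + ν 1 * (x - (1 / φ) • e) 1) / η := by
    rw [inner_plane, spinVelocity_zero, spinVelocity_one]
    simp only [PiLp.sub_apply, PiLp.smul_apply, smul_eq_mul]
    simp
    field_simp
    ring
  rw [e1, div_le_iff₀ hη]
  linarith

end

theorem lemma1 (P : FrictionData) (C : Set Plane) (hne : C.Nonempty) (hC : IsCompact C)
    (hbd : HasPiecewiseC1Boundary C) (Vmin Vmax : ℝ) (hVmin : 0 < Vmin) (hV : Vmin ≤ Vmax) :
    StandardModelISS P C Vmin Vmax ∧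
    ∀ (e : Plane) (φ₁ : ℝ), ‖e‖ = 1 → φ₁ ≠ 0 →
      (1 / φ₁) • e ∉ C →
      (∃ (ν : Plane) (η : ℝ), ν ≠ 0 ∧ 0 < η ∧
        ∀ x ∈ C, inner ℝ ν (x - (1 / φ₁) • e) < -η) →
      LargeSpinModelISS P C Vmin Vmax e φ₁ := by
  constructor
  -- The standard model is the case of zero spin, with `Φ = 0`. The first basis vector gives `⟨a, V⟩
  -- = -1`.
  · obtain ⟨β, γ, hβ, hγ, h⟩ := inputToState_of_transport P hC hbd hVmin hV
      isTransportField_standardVelocity hasFirstIntegrals_standardVelocity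
      (a := EuclideanSpace.single 0 1) (by simp [inner_plane, standardVelocity]) le_rfl
    refine ⟨β, γ, hβ, hγ, fun v Vr z₀ z hv hVr _ hz => h v Vr 0 z₀ z hv hVr (by simp) ?_⟩
    have h0 : spinMatrix 0 = 0 := by ext i j; fin_cases i <;> fin_cases j <;> simp [spinMatrix]
    simpa only [Pi.zero_apply, h0, mul_zero, sub_zero, IsStandardSolution] using hz
  · rintro e φ₁ - hφ - ⟨ν, η, -, hη, hν⟩ Φ
    -- `Φ` may be negative here, hence the bound `max Φ 0`.
    obtain ⟨β, γ, hβ, hγ, h⟩ := inputToState_of_transport P hC hbd hVmin hV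
      (isTransportField_spinVelocity e φ₁) (hasFirstIntegrals_spinVelocity e hφ)
      (inner_spinVelocity_le hφ hη hν) (le_max_right Φ 0)
    exact ⟨β, γ, hβ, hγ, fun v Vr φ₂ z₀ z hv hVr _ hφ₂ _ hz => h v Vr φ₂ z₀ z hv hVr
      (fun s hs => (hφ₂ s hs).trans (le_max_left _ _)) hz⟩
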